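/- Let $\mathbb K$ be a normed cone: a commutative topological monoid with neutral element $\mathbf e$ whose topology is Polish and comes from a metric $d$ (possibly with infinite values), with a jointly continuous multiplication by positive scalars such that $a(x+y)=ax+ay$, $a(bx)=(ab)x$, $1x=x$, $a\mathbf e=\mathbf e$, and with an origin $\mathbf 0$ such that $ax\to\mathbf 0$ as $a\downarrow0$ for all $x\ne\mathbf e$ and $d(ax,\mathbf 0)=a\,d(x,\mathbf 0)$ for all $a>0$, $x\in\mathbb K$. Write $\|x\|=d(x,\mathbf 0)$, $S=\{x:\|x\|=1\}$ and $\mathbb K'=\mathbb K\setminus\{\mathbf 0,\mathbf e\}$. Let $\xi_1,\xi_2,\dots$ be i.i.d. random elements of $\mathbb K'$ with a regularly varying tail of index $\alpha>0$ and spectral measure $\sigma$, a probability measure on $S$. That is, there is a slowly varying function $L$ such that for every Borel set $B\subset S$ with $\sigma(\partial B)=0$ $$\lim_{x\to\infty}\frac{x^\alpha}{L(x)}\,\mathbf P\Big\{\frac{\xi_1}{\|\xi_1\|}\in B,\ \|\xi_1\|>x\Big\}=\sigma(B).$$ Suppose moreover that for some $\beta\in(\alpha,\infty]$ and some real constants $C_1,C_2$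 $$\mathbf P\{\|\xi_1\|>x\}=C_1x^{-\alpha}+C_2x^{-\beta}+o(x^{-\beta}),\qquad x\to\infty,$$ which for $\beta=\infty$ means that $\mathbf P\{\|\xi_1\|>x\}=C_1x^{-\alpha}$ for all sufficiently large $x$. Put $\zeta=(\beta-\alpha)/\alpha\in(0,\infty]$; for $\zeta=\infty$ read $2\zeta/(1+2\zeta)=1$ and $1/(1+2\zeta)=0$. Let $n=n_N$ and $m=m_N$ be natural numbers with $nm\le N$ and, as $N\to\infty$, $$n\sim N^{2\zeta/(1+2\zeta)-\varepsilon_N},\qquad m\sim N^{1/(1+2\zeta)+\varepsilon_N},$$ where $(\varepsilon_N)$ is a real sequence with $\limsup_N\varepsilon_N<2\zeta/(1+2\zeta)$ and $N^{\varepsilon_N}\to\infty$ (for example, $\varepsilon_N$ is a small positive constant, or $\varepsilon_N\to0$ slowly enough). If $\beta=\infty$, suppose also that $m/\log N\to\infty$. Divide the first $nm$ of the elements $\xi_1,\dots,\xi_N$ into $n$ consecutive groups of $m$ elements each. For $1\le i\le n$ let $M^{(1)}_{m,i}\ge M^{(2)}_{m,i}$ be the largest and the second largest norm (counted with multiplicity)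 in the $i$-th group, and put $$\varkappa_{m,i}=\frac{M^{(2)}_{m,i}}{M^{(1)}_{m,i}},\qquad S_n=\sum_{i=1}^n\varkappa_{m,i},\qquad \hat\alpha_N=\frac{S_n}{n-S_n}.$$ Then, as $N\to\infty$, $$\frac{\sqrt n\,(\hat\alpha_N-\alpha)}{(\alpha+1)^2\Big(\frac1n\sum_{i=1}^n\varkappa_{m,i}^2-\big(\frac1nS_n\big)^2\Big)^{1/2}}\Rightarrow\mathcal N(0,1),$$ and the asymptotic variance of $\hat\alpha_N$ is $\alpha(\alpha+1)^2/(\alpha+2)$, that is, $$\sqrt n\,(\hat\alpha_N-\alpha)\Rightarrow\mathcal N\Big(0,\frac{\alpha(\alpha+1)^2}{\alpha+2}\Big).$$ -/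

import Mathlib

open Filter Topology MeasureTheory ProbabilityTheory Asymptotics
open scoped NNReal ENNReal

/-- A normed convex cone. The additive unit `0 : K` is the neutral element `e` of the semigroup; the
axioms `a (x + y) = a x + a y`, `a (b x) = (a b) x`, `1 x = x`, `a e = e` are those of
`DistribMulAction`. The origin may differ from `e`, and the metric (which induces the topology) may
take the value `∞`. -/
class NormedCone (K : Type*) [EMetricSpace K] [AddCommMonoid K]
    [DistribMulAction {a : ℝ // 0 < a} K] : Prop extends
    PolishSpace K, ContinuousAdd K, ContinuousSMul {a : ℝ // 0 < a} K where
  /-- There is an origin, to which `a x` tends as `a ↓ 0` for every `x ≠ e`, and at which the metric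
  is homogeneous. -/
  exists_origin : ∃ o : K,
    (∀ x : K, x ≠ 0 →
      Tendsto (fun a : {a : ℝ // 0 < a} => a • x) (comap Subtype.val (𝓝 (0 : ℝ))) (𝓝 o)) ∧
    ∀ (a : {a : ℝ // 0 < a}) (x : K), edist (a • x) o = ENNReal.ofReal a * edist x o

namespace NormedCone

noncomputable section

variable (K : Type*) [EMetricSpace K] [AddCommMonoid K] [DistribMulAction {a : ℝ // 0 < a} K]
  [NormedCone K]

/-- The origin of the cone. -/
def origin : K := Classical.choose (exists_origin (K := K))

/-- The unit sphere `S = {x | ‖x‖ = 1}`. -/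
def unitSphere : Set K := {x | edist x (origin K) = 1}

variable {K}

/-- The norm `‖x‖ = d(x, origin)`; it is finite for every `x ≠ e`. -/
def cnorm (x : K) : ℝ≥0 := (edist x (origin K)).toNNReal

/-- The radial projection `x / ‖x‖` (the identity where the norm is not positive). -/
def direction (x : K) : K :=
  if h : 0 < (cnorm x : ℝ) then
    (⟨(cnorm x : ℝ)⁻¹, inv_pos.2 h⟩ : {a : ℝ // 0 < a}) • x
  else x

variable (K) in
/-- `K' = K \ {origin, e}`. -/
def punctured : Set K := {origin K, 0}ᶜ

end

end NormedCone

/-- `L` is slowly varying at infinity. -/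
def SlowlyVarying (L : ℝ → ℝ) : Prop :=
  (∀ᶠ x in atTop, 0 < L x) ∧
    ∀ l : ℝ, 0 < l → Tendsto (fun x => L (l * x) / L x) atTop (𝓝 1)

/-- `X ∈ VR(α, σ)`: `X` has a regularly varying tail with tail index `α` and spectral
measure `σ`. -/
def RegularlyVaryingTail {K : Type*} [EMetricSpace K] [AddCommMonoid K]
    [DistribMulAction {a : ℝ // 0 < a} K] [NormedCone K] [MeasurableSpace K]
    {Ω : Type*} [MeasurableSpace Ω] (P : Measure Ω) (X : Ω → K)
    (α : ℝ) (σ : Measure (NormedCone.unitSphere K)) : Prop :=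
  0 < α ∧ ∃ L : ℝ → ℝ, SlowlyVarying L ∧
    ∀ B : Set (NormedCone.unitSphere K), MeasurableSet B → σ (frontier B) = 0 →
      Tendsto
        (fun x : ℝ => x ^ α / L x *
          P.real {ω | NormedCone.direction (X ω) ∈ Subtype.val '' B ∧
            x < NormedCone.cnorm (X ω)})
        atTop (𝓝 (σ.real B))

/-- `G x = C₁ x ^ (-α) + C₂ x ^ (-β) + o (x ^ (-β))` as `x → ∞`. For `β = ∞` one has
`x ^ (-β) = 0` for `x > 1`, so that the relation reads `G x = C₁ x ^ (-α)` for large `x`. -/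
def SecondOrderTail (G : ℝ → ℝ) (α : ℝ) : WithTop ℝ → Prop
  | ⊤ => ∃ C₁ : ℝ, ∀ᶠ x in atTop, G x = C₁ * x ^ (-α)
  | (b : ℝ) => ∃ C₁ C₂ : ℝ,
      (fun x : ℝ => G x - (C₁ * x ^ (-α) + C₂ * x ^ (-b))) =o[atTop] fun x : ℝ => x ^ (-b)

/-- The exponent `2ζ / (1 + 2ζ)` with `ζ = (β - α) / α` (equal to `1` for `β = ∞`). -/
noncomputable def groupNumberExponent (α : ℝ) : WithTop ℝ → ℝ
  | ⊤ => 1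
  | (b : ℝ) => 2 * ((b - α) / α) / (1 + 2 * ((b - α) / α))

/-- The exponent `1 / (1 + 2ζ)` with `ζ = (β - α) / α` (equal to `0` for `β = ∞`). -/
noncomputable def groupSizeExponent (α : ℝ) : WithTop ℝ → ℝ
  | ⊤ => 0
  | (b : ℝ) => 1 / (1 + 2 * ((b - α) / α))

/-- The largest of the values `a 0, …, a (m - 1)`. -/
noncomputable def largest {m : ℕ} (a : Fin m → ℝ≥0) : ℝ≥0 := Finset.univ.sup a

/-- The second largest of the values `a 0, …, a (m - 1)`, counted with multiplicity: one occurrence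
of the largest value is removed. -/
noncomputable def secondLargest {m : ℕ} (a : Fin m → ℝ≥0) : ℝ≥0 :=
  (((Finset.univ : Finset (Fin m)).val.map a).erase (largest a)).sup

/-- `ϰ_{m,i}`, `i = 0, 1, …`, for the sequence of norms `y`: the ratio of the second largest to the
largest value in the `i`-th group `y (i m), …, y (i m + m - 1)` of size `m`. -/
noncomputable def kappa (y : ℕ → ℝ≥0) (m i : ℕ) : ℝ :=
  (secondLargest fun j : Fin m => y (i * m + j)) / (largest fun j : Fin m => y (i * m + j))

/-- `S_n`, the sum of the ratios over the first `n` groups of size `m`. -/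
noncomputable def kappaSum (y : ℕ → ℝ≥0) (n m : ℕ) : ℝ := ∑ i ∈ Finset.range n, kappa y m i

/-- The estimator `S_n / (n - S_n)` of the tail index. -/
noncomputable def tailIndexEstimator (y : ℕ → ℝ≥0) (n m : ℕ) : ℝ :=
  kappaSum y n m / (n - kappaSum y n m)

/-- The empirical variance of the ratios. -/
noncomputable def kappaVariance (y : ℕ → ℝ≥0) (n m : ℕ) : ℝ :=
  1 / n * ∑ i ∈ Finset.range n, kappa y m i ^ 2 - (1 / n * kappaSum y n m) ^ 2

/-! For exact Pareto norms, with tail `x ^ (-α)`, the ratio of the second largest to the largest of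
`m ≥ 2` values has distribution function `t ^ α` on `[0, 1]`, whatever `m` is
(`map_topRatio_pi_paretoLaw`). The group ratios are then i.i.d. with mean `α / (α + 1)` and variance
`α / ((α + 1) ^ 2 * (α + 2))`. The estimator is `x / (1 - x)` applied to their average, so the law
of large numbers, the central limit theorem and the delta method give both limits
(`tendstoInDistribution_estimator`).

A general law of the norm is coupled with the Pareto law by a monotone quantile map `T`
(`map_paretoQuantile`). Monotonicity keeps the order statistics in place, so a group ratio becomes
`T x / T y` with `x ≤ y` the two largest Pareto values. With `δ = β - α`, the second-order tail
makes `T` asymptotically linear, `T z / z = c + O(z ^ (-δ))`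
(`exists_paretoQuantile_asymptotically_linear`), so each ratio moves by `O(x ^ (-δ))`. Since `x ^
(-α)` is of order `1 / m`, the mean displacement is `O(m ^ (-ζ))` with `ζ = δ / α`, plus an
exponentially small term for the event that `x` lies outside the range of the expansion
(`lintegral_abs_topRatio_comp_sub_le`). The sizes `n` and `m` are such that `√n * m ^ (-ζ) → 0`
(`tendsto_sqrt_mul_rpow`), so the displacement does not affect the limit. For `β = ⊤` only the
exponential term remains, and `m / log N → ∞` removes it.

Regular variation supplies the positivity of the leading tail coefficient
(`SecondOrderTail.exists_pos`). -/

/-! ### The two largest values of a finite family -/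

/-- The ratio of the second largest to the largest value. -/
noncomputable def topRatio {m : ℕ} (a : Fin m → ℝ≥0) : ℝ := secondLargest a / largest a

lemma le_largest {m : ℕ} (a : Fin m → ℝ≥0) (i : Fin m) : a i ≤ largest a :=
  Finset.le_sup (f := a) (Finset.mem_univ i)

lemma exists_eq_largest {m : ℕ} (hm : 0 < m) (a : Fin m → ℝ≥0) : ∃ j, a j = largest a := by
  obtain ⟨j, -, hj⟩ := Finset.exists_mem_eq_sup Finset.univ ⟨⟨0, hm⟩, Finset.mem_univ _⟩ a
  exact ⟨j, hj.symm⟩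

lemma secondLargest_eq_sup_erase {m : ℕ} (a : Fin m → ℝ≥0) {j : Fin m} (hj : a j = largest a) :
    secondLargest a = (Finset.univ.erase j).sup a := by
  rw [secondLargest, ← hj, Finset.sup_def, Finset.erase_val,
    Multiset.map_erase_of_mem _ _ (Finset.mem_univ j)]

lemma secondLargest_le_largest {m : ℕ} (a : Fin m → ℝ≥0) : secondLargest a ≤ largest a := by
  refine Multiset.sup_le.2 fun b hb => ?_
  obtain ⟨i, -, rfl⟩ := Multiset.mem_map.1 (Multiset.mem_of_mem_erase hb)
  exact le_largest a i

/-- An exceptional index that is not a maximiser can be dropped, because the largest value is then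
itself at most `x`. The form without a choice of maximiser yields measurability and the block
argument for small values. -/
lemma secondLargest_le_iff {m : ℕ} (hm : 0 < m) (a : Fin m → ℝ≥0) (x : ℝ≥0) :
    secondLargest a ≤ x ↔ ∃ j, ∀ i, i ≠ j → a i ≤ x := by
  obtain ⟨j, hj⟩ := exists_eq_largest hm a
  rw [secondLargest_eq_sup_erase a hj]
  simp only [Finset.sup_le_iff, Finset.mem_erase, Finset.mem_univ, and_true]
  refine ⟨fun h => ⟨j, h⟩, fun ⟨k, hk⟩ i hi => ?_⟩
  by_cases hik : i = k
  · subst hik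
    exact (le_largest a i).trans (hj ▸ hk j hi.symm)
  · exact hk i hik

lemma topRatio_nonneg {m : ℕ} (a : Fin m → ℝ≥0) : 0 ≤ topRatio a := by
  unfold topRatio; positivity

lemma topRatio_le_one {m : ℕ} (a : Fin m → ℝ≥0) : topRatio a ≤ 1 :=
  div_le_one_of_le₀ (NNReal.coe_le_coe.2 (secondLargest_le_largest a)) (NNReal.coe_nonneg _)

/-- As `t ≤ 1`, an index that dominates the others by the factor `t` must be a maximiser. The event
thus splits over the dominating index. -/
lemma topRatio_lt_iff {m : ℕ} (hm : 0 < m) (a : Fin m → ℝ≥0) (ha : 0 < largest a) {t : ℝ≥0}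
    (ht : 0 < t) (ht1 : t ≤ 1) : topRatio a < t ↔ ∃ j, ∀ i, i ≠ j → a i < t * a j := by
  have key : topRatio a < t ↔ secondLargest a < t * largest a := by
    rw [topRatio, div_lt_iff₀ (NNReal.coe_pos.2 ha)]
    norm_cast
  rw [key]
  obtain ⟨j, hj⟩ := exists_eq_largest hm a
  have hlt : ∀ {k : Fin m}, a k = largest a →
      (secondLargest a < t * largest a ↔ ∀ i, i ≠ k → a i < t * a k) := by
    intro k hk
    rw [secondLargest_eq_sup_erase a hk, hk, Finset.sup_lt_iff (by simpa using mul_pos ht ha)]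
    simp
  refine ⟨fun h => ⟨j, (hlt hj).1 h⟩, fun ⟨k, hk⟩ => ?_⟩
  have hkl : a k = largest a := by
    by_contra hne
    have hjk : j ≠ k := by rintro rfl; exact hne hj
    have h1 := (hk j hjk).trans_le (mul_le_of_le_one_left (zero_le : (0 : ℝ≥0) ≤ a k) ht1)
    exact absurd (hj ▸ h1) (not_lt.2 (le_largest a k))
  exact (hlt hkl).2 hk

/-- Monotone maps commute with finite nonempty suprema; `T 0 = 0` covers the empty ones, which here
means `m = 0` and, for the second largest value, also `m = 1`. -/
lemma largest_comp {m : ℕ} {T : ℝ≥0 → ℝ≥0} (hT : Monotone T) (hT0 : T 0 = 0)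
    (a : Fin m → ℝ≥0) : largest (fun i => T (a i)) = T (largest a) :=
  (Finset.apply_sup_eq_sup_comp T (fun x y => hT.map_sup x y) (by simpa using hT0)).symm

lemma secondLargest_comp {m : ℕ} {T : ℝ≥0 → ℝ≥0} (hT : Monotone T) (hT0 : T 0 = 0)
    (a : Fin m → ℝ≥0) : secondLargest (fun i => T (a i)) = T (secondLargest a) := by
  rcases Nat.eq_zero_or_pos m with rfl | hm
  · simp [secondLargest, hT0]
  · obtain ⟨j, hj⟩ := exists_eq_largest hm a
    rw [secondLargest_eq_sup_erase a hj, secondLargest_eq_sup_erase (j := j) _ (by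
      rw [largest_comp hT hT0, hj])]
    exact (Finset.apply_sup_eq_sup_comp T (fun x y => hT.map_sup x y) (by simpa using hT0)).symm

@[fun_prop]
lemma measurable_largest {m : ℕ} : Measurable (largest : (Fin m → ℝ≥0) → ℝ≥0) := by
  refine measurable_of_Iic fun x => ?_
  have : largest ⁻¹' Set.Iic x = ⋂ i : Fin m, {a : Fin m → ℝ≥0 | a i ≤ x} := by
    ext a; simp [largest]
  rw [this]
  exact MeasurableSet.iInter fun i => measurableSet_le (measurable_pi_apply i) measurable_const

@[fun_prop]
lemma measurable_secondLargest {m : ℕ} : Measurable (secondLargest : (Fin m → ℝ≥0) → ℝ≥0) := by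
  rcases Nat.eq_zero_or_pos m with rfl | hm
  · exact Subsingleton.measurable
  refine measurable_of_Iic fun x => ?_
  have : secondLargest ⁻¹' Set.Iic x =
      ⋃ j : Fin m, ⋂ i : Fin m, ⋂ _ : i ≠ j, {a : Fin m → ℝ≥0 | a i ≤ x} := by
    ext a; simp [secondLargest_le_iff hm]
  rw [this]
  exact MeasurableSet.iUnion fun j => MeasurableSet.iInter fun i => MeasurableSet.iInter fun _ =>
    measurableSet_le (measurable_pi_apply i) measurable_const

@[fun_prop]
lemma measurable_topRatio {m : ℕ} : Measurable (topRatio : (Fin m → ℝ≥0) → ℝ) := by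
  unfold topRatio
  fun_prop

lemma measurable_kappa (m i : ℕ) : Measurable fun y : ℕ → ℝ≥0 => kappa y m i :=
  measurable_topRatio.comp (measurable_pi_lambda _ fun _ => measurable_pi_apply _)

/-! ### The Pareto law and the ratio of the two largest Pareto variables -/

/-- The uniform law on the unit interval. -/
noncomputable def unitUniform : Measure ℝ := volume.restrict (Set.Ioo 0 1)

instance : IsProbabilityMeasure unitUniform := ⟨by simp [unitUniform]⟩

/-- `u ^ (-1 / α)`, which has the Pareto law of index `α` if `u` is uniform. -/
noncomputable def paretoOfUniform (α u : ℝ) : ℝ≥0 := u.toNNReal ^ (-(1 / α))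

@[fun_prop]
lemma measurable_paretoOfUniform (α : ℝ) : Measurable (paretoOfUniform α) := by
  unfold paretoOfUniform; fun_prop

/-- The Pareto law of index `α`. -/
noncomputable def paretoLaw (α : ℝ) : Measure ℝ≥0 := unitUniform.map (paretoOfUniform α)

instance (α : ℝ) : IsProbabilityMeasure (paretoLaw α) :=
  Measure.isProbabilityMeasure_map (measurable_paretoOfUniform α).aemeasurable

lemma coe_paretoOfUniform {α u : ℝ} (hu : 0 < u) :
    (paretoOfUniform α u : ℝ) = u ^ (-(1 / α)) := by
  rw [paretoOfUniform, NNReal.coe_rpow, Real.coe_toNNReal _ hu.le]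

lemma paretoOfUniform_pos {α u : ℝ} (hu : 0 < u) : 0 < paretoOfUniform α u := by
  rw [← NNReal.coe_pos, coe_paretoOfUniform hu]; positivity

lemma paretoOfUniform_rpow {α u : ℝ} (hα : 0 < α) (hu : 0 < u) :
    (paretoOfUniform α u : ℝ) ^ (-α) = u := by
  rw [coe_paretoOfUniform hu, ← Real.rpow_mul hu.le]
  simp [hα.ne']

lemma paretoOfUniform_lt_iff {α u : ℝ} (hα : 0 < α) (hu : 0 < u) {x : ℝ≥0} (hx : 0 < x) :
    paretoOfUniform α u < x ↔ (x : ℝ) ^ (-α) < u := by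
  rw [← NNReal.coe_lt_coe, ← Real.rpow_lt_rpow_iff_of_neg (NNReal.coe_pos.2 hx)
    (NNReal.coe_pos.2 (paretoOfUniform_pos hu)) (neg_lt_zero.2 hα),
    paretoOfUniform_rpow hα hu]

lemma ae_unitUniform_mem : ∀ᵐ u ∂unitUniform, u ∈ Set.Ioo (0 : ℝ) 1 :=
  ae_restrict_mem measurableSet_Ioo

lemma unitUniform_Ioi {s : ℝ} (hs : 0 ≤ s) : unitUniform (Set.Ioi s) = ENNReal.ofReal (1 - s) := by
  rw [unitUniform, Measure.restrict_apply measurableSet_Ioi]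
  have : Set.Ioi s ∩ Set.Ioo 0 1 = Set.Ioo s 1 := by
    ext u
    simp only [Set.mem_inter_iff, Set.mem_Ioi, Set.mem_Ioo]
    constructor
    · rintro ⟨h, -, h1⟩; exact ⟨h, h1⟩
    · rintro ⟨h, h1⟩; exact ⟨h, hs.trans_lt h, h1⟩
  rw [this, Real.volume_Ioo]

lemma unitUniform_Ici {s : ℝ} (hs : 0 ≤ s) : unitUniform (Set.Ici s) = ENNReal.ofReal (1 - s) := by
  rw [← unitUniform_Ioi hs]
  exact (measure_congr (ae_restrict_of_ae Ioi_ae_eq_Ici : Set.Ioi s =ᵐ[unitUniform] Set.Ici s)).symm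

lemma unitUniform_Iio {s : ℝ} (hs1 : s ≤ 1) : unitUniform (Set.Iio s) = ENNReal.ofReal s := by
  rw [unitUniform, Measure.restrict_apply measurableSet_Iio]
  have : Set.Iio s ∩ Set.Ioo 0 1 = Set.Ioo 0 s := by
    ext u
    simp only [Set.mem_inter_iff, Set.mem_Iio, Set.mem_Ioo]
    constructor
    · rintro ⟨h, h0, -⟩; exact ⟨h0, h⟩
    · rintro ⟨h, h1⟩; exact ⟨h1, h, h1.trans_le hs1⟩
  rw [this, Real.volume_Ioo, sub_zero]

/-- For `x < 1` the difference is negative and `ENNReal.ofReal` truncates it to `0`, so one formula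
covers every `x > 0`. -/
lemma paretoLaw_Iio {α : ℝ} (hα : 0 < α) {x : ℝ≥0} (hx : 0 < x) :
    paretoLaw α (Set.Iio x) = ENNReal.ofReal (1 - (x : ℝ) ^ (-α)) := by
  rw [paretoLaw, Measure.map_apply (measurable_paretoOfUniform α) measurableSet_Iio,
    ← unitUniform_Ioi (by positivity)]
  refine measure_congr ?_
  filter_upwards [ae_unitUniform_mem] with u hu
  exact propext (paretoOfUniform_lt_iff hα hu.1 hx)

lemma ae_paretoLaw_pos (α : ℝ) : ∀ᵐ z ∂paretoLaw α, 0 < z := by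
  rw [paretoLaw, ae_map_iff (measurable_paretoOfUniform α).aemeasurable measurableSet_Ioi]
  filter_upwards [ae_unitUniform_mem] with u hu using paretoOfUniform_pos hu.1

lemma ae_pi_paretoLaw_pos (α : ℝ) (m : ℕ) :
    ∀ᵐ a ∂Measure.pi fun _ : Fin m => paretoLaw α, ∀ i, 0 < a i :=
  ae_all_iff.2 fun _ => Measure.tendsto_eval_ae_ae.eventually (ae_paretoLaw_pos α)

/-- The truncation in `ENNReal.ofReal` cuts the integral off at `u = c`, leaving `∫₀ᶜ (1 - u / c) ^
k`. For `k = 0` the cut-off would fail because `0 ^ 0 = 1`. -/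
lemma lintegral_one_sub_mul_pow {c : ℝ} (hc : 0 < c) (hc1 : c ≤ 1) {k : ℕ} (hk : k ≠ 0) :
    ∫⁻ u, ENNReal.ofReal (1 - c⁻¹ * u) ^ k ∂unitUniform = ENNReal.ofReal (c / (k + 1)) := by
  have h1 : ∫⁻ u, ENNReal.ofReal (1 - c⁻¹ * u) ^ k ∂unitUniform =
      ∫⁻ u in Set.Ioc 0 c, ENNReal.ofReal ((1 - u / c) ^ k) := by
    rw [unitUniform, ← lintegral_indicator measurableSet_Ioo, ← lintegral_indicator
      measurableSet_Ioc]
    refine lintegral_congr_ae ?_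
    filter_upwards [Measure.ae_ne volume (1 : ℝ)] with u hu1
    by_cases h : u ∈ Set.Ioc 0 c
    · have h' : u ∈ Set.Ioo (0 : ℝ) 1 := ⟨h.1, lt_of_le_of_ne (h.2.trans hc1) hu1⟩
      rw [Set.indicator_of_mem h, Set.indicator_of_mem h', ENNReal.ofReal_pow, div_eq_inv_mul]
      rw [sub_nonneg]; exact (div_le_one hc).2 h.2
    · rw [Set.indicator_of_notMem h]
      by_cases h' : u ∈ Set.Ioo (0 : ℝ) 1
      · rw [Set.indicator_of_mem h', ENNReal.ofReal_of_nonpos, zero_pow hk]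
        have : c < u := by
          by_contra hle
          exact h ⟨h'.1, not_lt.1 hle⟩
        rw [sub_nonpos, ← div_eq_inv_mul]
        exact (one_le_div hc).2 this.le
      · rw [Set.indicator_of_notMem h']
  rw [h1, ← ofReal_integral_eq_lintegral_ofReal]
  · congr 1
    rw [← intervalIntegral.integral_of_le hc.le,
      intervalIntegral.integral_comp_sub_div (fun x => x ^ k) hc.ne']
    simp [hc.ne']
    ring
  · exact (Continuous.integrableOn_Ioc (by fun_prop))
  · filter_upwards [ae_restrict_mem measurableSet_Ioc] with u hu
    have : 0 ≤ 1 - u / c := by rw [sub_nonneg]; exact (div_le_one hc).2 hu.2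
    positivity

/-- Condition on `a j = u ^ (-1 / α)`: the other `k` values independently fall below `t * a j` with
probability `(1 - t ^ (-α) * u)₊`, and it remains to integrate over `u`. -/
lemma pi_paretoLaw_dominating {α : ℝ} (hα : 0 < α) {t : ℝ≥0} (ht : 0 < t) (ht1 : t ≤ 1)
    {k : ℕ} (hk : k ≠ 0) (j : Fin (k + 1)) :
    (Measure.pi fun _ : Fin (k + 1) => paretoLaw α) {a | ∀ i, i ≠ j → a i < t * a j} =
      ENNReal.ofReal ((t : ℝ) ^ α / (k + 1)) := by
  have hmeas : MeasurableSet {p : ℝ≥0 × (Fin k → ℝ≥0) | ∀ i, p.2 i < t * p.1} := by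
    rw [Set.ofPred_forall]
    exact MeasurableSet.iInter fun i => measurableSet_lt (by fun_prop) (by fun_prop)
  have hpre : {a : Fin (k + 1) → ℝ≥0 | ∀ i, i ≠ j → a i < t * a j} =
      MeasurableEquiv.piFinSuccAbove (fun _ => ℝ≥0) j ⁻¹'
        {p : ℝ≥0 × (Fin k → ℝ≥0) | ∀ i, p.2 i < t * p.1} := by
    ext a
    simp [Fin.forall_iff_succAbove j, Fin.succAbove_ne, MeasurableEquiv.piFinSuccAbove,
      Fin.insertNthEquiv, Fin.removeNth]
  rw [hpre, (measurePreserving_piFinSuccAbove (fun _ => paretoLaw α) j).measure_preimage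
    hmeas.nullMeasurableSet, Measure.prod_apply hmeas]
  have hslice : ∀ y : ℝ≥0, (Measure.pi fun _ : Fin k => paretoLaw α)
      (Prod.mk y ⁻¹' {p : ℝ≥0 × (Fin k → ℝ≥0) | ∀ i, p.2 i < t * p.1}) =
        paretoLaw α (Set.Iio (t * y)) ^ k := by
    intro y
    have : Prod.mk y ⁻¹' {p : ℝ≥0 × (Fin k → ℝ≥0) | ∀ i, p.2 i < t * p.1} =
        Set.univ.pi fun _ => Set.Iio (t * y) := by
      ext b; simp
    rw [this, Measure.pi_pi]
    simp
  calc _ = ∫⁻ y, paretoLaw α (Set.Iio (t * y)) ^ k ∂paretoLaw α :=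
        lintegral_congr fun y => hslice y
    _ = ∫⁻ y, ENNReal.ofReal (1 - ((t * y : ℝ≥0) : ℝ) ^ (-α)) ^ k ∂paretoLaw α := by
        refine lintegral_congr_ae ?_
        filter_upwards [ae_paretoLaw_pos α] with y hy
        rw [paretoLaw_Iio hα (mul_pos ht hy)]
    _ = ∫⁻ u, ENNReal.ofReal (1 - ((t : ℝ) ^ α)⁻¹ * u) ^ k ∂unitUniform := by
        conv_lhs => rw [paretoLaw]
        rw [lintegral_map (by fun_prop) (measurable_paretoOfUniform α)]
        refine lintegral_congr_ae ?_
        filter_upwards [ae_unitUniform_mem] with u hu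
        rw [NNReal.coe_mul, Real.mul_rpow (NNReal.coe_nonneg _) (NNReal.coe_nonneg _),
          paretoOfUniform_rpow hα hu.1, Real.rpow_neg (NNReal.coe_nonneg _)]
    _ = _ := lintegral_one_sub_mul_pow (Real.rpow_pos_of_pos (NNReal.coe_pos.2 ht) _)
        (Real.rpow_le_one (NNReal.coe_nonneg _) (by exact_mod_cast ht1) hα.le) hk

/-- The `m` choices of the dominating index give disjoint events of probability `t ^ α / m` each, so
the dependence on `m` cancels. -/
lemma pi_paretoLaw_topRatio_lt {α : ℝ} (hα : 0 < α) {m : ℕ} (hm : 2 ≤ m) {t : ℝ≥0} (ht : 0 < t)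
    (ht1 : t ≤ 1) :
    (Measure.pi fun _ : Fin m => paretoLaw α) {a | topRatio a < t} =
      ENNReal.ofReal ((t : ℝ) ^ α) := by
  obtain ⟨k, rfl⟩ : ∃ k, m = k + 1 := ⟨m - 1, by omega⟩
  have hk : k ≠ 0 := by omega
  have hE : ({a | topRatio a < t} : Set (Fin (k + 1) → ℝ≥0))
      =ᵐ[Measure.pi fun _ : Fin (k + 1) => paretoLaw α]
      ⋃ j, {a | ∀ i, i ≠ j → a i < t * a j} := by
    filter_upwards [ae_pi_paretoLaw_pos α (k + 1)] with a ha
    refine propext ?_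
    change a ∈ {a | topRatio a < t} ↔ a ∈ ⋃ j, {a | ∀ i, i ≠ j → a i < t * a j}
    simpa using topRatio_lt_iff k.succ_pos a ((ha 0).trans_le (le_largest a 0)) ht ht1
  rw [measure_congr hE, measure_iUnion]
  · rw [tsum_fintype, Finset.sum_congr rfl fun j _ => pi_paretoLaw_dominating hα ht ht1 hk j]
    rw [Finset.sum_const, Finset.card_univ, Fintype.card_fin, nsmul_eq_mul,
      ← ENNReal.ofReal_natCast, ← ENNReal.ofReal_mul (by positivity)]
    congr 1
    push_cast
    field_simp
  · intro j l hjl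
    refine Set.disjoint_left.2 fun a h1 h2 => ?_
    have h3 := (h1 l hjl.symm).trans_le (mul_le_of_le_one_left (zero_le : (0 : ℝ≥0) ≤ a j) ht1)
    have h4 := (h2 j hjl).trans_le (mul_le_of_le_one_left (zero_le : (0 : ℝ≥0) ≤ a l) ht1)
    exact lt_asymm h3 h4
  · intro j
    rw [Set.ofPred_forall]
    refine MeasurableSet.iInter fun i => ?_
    rw [Set.ofPred_forall]
    exact MeasurableSet.iInter fun _ => measurableSet_lt (by fun_prop) (by fun_prop)

/-- The law of `u ^ (1 / α)` for a uniform `u`. -/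
noncomputable def ratioLaw (α : ℝ) : Measure ℝ := unitUniform.map fun u => u ^ (1 / α)

instance (α : ℝ) : IsProbabilityMeasure (ratioLaw α) :=
  Measure.isProbabilityMeasure_map (by fun_prop)

lemma map_topRatio_pi_paretoLaw {α : ℝ} (hα : 0 < α) {m : ℕ} (hm : 2 ≤ m) :
    (Measure.pi fun _ : Fin m => paretoLaw α).map topRatio = ratioLaw α := by
  have : IsProbabilityMeasure ((Measure.pi fun _ : Fin m => paretoLaw α).map topRatio) :=
    Measure.isProbabilityMeasure_map measurable_topRatio.aemeasurable
  suffices h : ∀ t : ℝ, ((Measure.pi fun _ : Fin m => paretoLaw α).map topRatio) (Set.Iio t) =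
      ratioLaw α (Set.Iio t) by
    refine Measure.ext_of_Ici _ _ fun t => ?_
    rw [← Set.compl_Iio, prob_compl_eq_one_sub measurableSet_Iio,
      prob_compl_eq_one_sub measurableSet_Iio, h]
  intro t
  rw [Measure.map_apply measurable_topRatio measurableSet_Iio, ratioLaw,
    Measure.map_apply (by fun_prop) measurableSet_Iio]
  have hunif : unitUniform ((fun u : ℝ => u ^ (1 / α)) ⁻¹' Set.Iio t) =
      unitUniform {u | 0 < t ∧ u < t ^ α} := by
    refine measure_congr ?_
    filter_upwards [ae_unitUniform_mem] with u hu
    refine propext ?_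
    change u ^ (1 / α) < t ↔ 0 < t ∧ u < t ^ α
    have hpos : 0 < u ^ (1 / α) := Real.rpow_pos_of_pos hu.1 _
    rw [one_div]
    constructor
    · intro h
      have ht : 0 < t := by rw [one_div] at hpos; exact hpos.trans h
      exact ⟨ht, (Real.rpow_inv_lt_iff_of_pos hu.1.le ht.le hα).1 h⟩
    · rintro ⟨ht, h⟩
      exact (Real.rpow_inv_lt_iff_of_pos hu.1.le ht.le hα).2 h
  rw [hunif]
  rcases le_or_gt t 0 with ht | ht
  · have h1 : topRatio ⁻¹' Set.Iio t = (∅ : Set (Fin m → ℝ≥0)) := by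
      ext a
      simp only [Set.mem_preimage, Set.mem_Iio, Set.mem_empty_iff_false, iff_false, not_lt]
      exact ht.trans (topRatio_nonneg a)
    simp [h1, not_lt.2 ht]
  simp only [ht, true_and]
  rcases le_or_gt t 1 with ht1 | ht1
  · have := pi_paretoLaw_topRatio_lt hα hm (t := ⟨t, ht.le⟩) ht (by exact_mod_cast ht1)
    exact this.trans (unitUniform_Iio (Real.rpow_le_one ht.le ht1 hα.le)).symm
  · have h1 : topRatio ⁻¹' Set.Iio t = (Set.univ : Set (Fin m → ℝ≥0)) :=
      Set.eq_univ_of_forall fun a => (topRatio_le_one a).trans_lt ht1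
    rw [h1, measure_univ, eq_comm]
    refine mem_ae_iff_prob_eq_one (measurableSet_lt measurable_id measurable_const) |>.1 ?_
    filter_upwards [ae_unitUniform_mem] with u hu
    exact hu.2.trans (Real.one_lt_rpow ht1 hα)

lemma integral_pow_ratioLaw {α : ℝ} (hα : 0 < α) (r : ℕ) :
    ∫ x, x ^ r ∂ratioLaw α = α / (α + r) := by
  rw [ratioLaw, integral_map (by fun_prop) (by fun_prop), unitUniform,
    ← integral_Ioc_eq_integral_Ioo, ← intervalIntegral.integral_of_le zero_le_one]
  have : ∀ u ∈ Set.uIcc (0 : ℝ) 1, (u ^ (1 / α)) ^ r = u ^ (r / α) := by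
    intro u hu
    rw [Set.uIcc_of_le zero_le_one] at hu
    rw [← Real.rpow_natCast, ← Real.rpow_mul hu.1]
    congr 1
    ring
  rw [intervalIntegral.integral_congr this,
    integral_rpow (Or.inl (neg_one_lt_zero.trans_le (by positivity)))]
  have h0 : (r : ℝ) / α + 1 ≠ 0 := by positivity
  rw [Real.one_rpow, Real.zero_rpow h0]
  field_simp
  ring

lemma ae_ratioLaw_mem {α : ℝ} (hα : 0 < α) : ∀ᵐ x ∂ratioLaw α, x ∈ Set.Icc (0 : ℝ) 1 := by
  refine (ae_map_iff (by fun_prop) measurableSet_Icc).2 ?_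
  filter_upwards [ae_unitUniform_mem] with u hu
  exact ⟨Real.rpow_nonneg hu.1.le _, Real.rpow_le_one hu.1.le hu.2.le (by positivity)⟩

/-! ### The effect of an asymptotically linear change of scale on the ratio -/

/-- With `p = T x / x` and `q = T y / y` at the two largest values `x ≤ y`, the displacement is `x /
y * ((p - q) / q)`. Both slopes are within `D * x ^ (-δ)` of `c`, and `q ≥ c / 2`. -/
lemma abs_topRatio_comp_sub_le {m : ℕ} {T : ℝ≥0 → ℝ≥0} (hT : Monotone T) (hT0 : T 0 = 0)
    {c D δ : ℝ} {z₀ : ℝ≥0} (hc : 0 < c) (hD : 0 ≤ D) (hδ : 0 < δ) (hz₀ : 0 < z₀)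
    (hlin : ∀ z, z₀ ≤ z → |(T z / z : ℝ) - c| ≤ D * (z : ℝ) ^ (-δ))
    (hlow : ∀ z, z₀ ≤ z → c / 2 ≤ (T z / z : ℝ)) (a : Fin m → ℝ≥0)
    (ha : z₀ ≤ secondLargest a) :
    |topRatio (fun i => T (a i)) - topRatio a| ≤ 4 * D / c * (secondLargest a : ℝ) ^ (-δ) := by
  rw [topRatio, topRatio, largest_comp hT hT0, secondLargest_comp hT hT0]
  have hle := secondLargest_le_largest a
  set x := secondLargest a
  set y := largest a
  have hx : (0 : ℝ) < x := NNReal.coe_pos.2 (hz₀.trans_le ha)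
  have hxy : (x : ℝ) ≤ y := NNReal.coe_le_coe.2 hle
  have hy : (0 : ℝ) < y := hx.trans_le hxy
  have h1 := hlin x ha
  have h2 := hlin y (ha.trans hle)
  have h3 := hlow y (ha.trans hle)
  have h4 : D * (y : ℝ) ^ (-δ) ≤ D * (x : ℝ) ^ (-δ) :=
    mul_le_mul_of_nonneg_left (Real.rpow_le_rpow_of_nonpos hx hxy (by linarith)) hD
  set p := (T x / x : ℝ) with hp
  set q := (T y / y : ℝ) with hq
  have hqpos : 0 < q := by linarith
  have hTx : (T x : ℝ) = p * x := by rw [hp]; field_simp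
  have hTy : (T y : ℝ) = q * y := by rw [hq]; field_simp
  have heq : (T x : ℝ) / T y - x / y = x / y * ((p - q) / q) := by
    rw [hTx, hTy]; field_simp
  have hpq : |p - q| ≤ 2 * (D * (x : ℝ) ^ (-δ)) := by
    have : p - q = (p - c) - (q - c) := by ring
    rw [this]
    exact (abs_sub _ _).trans (by linarith)
  have hxy1 : (x : ℝ) / y ≤ 1 := (div_le_one hy).2 hxy
  calc |(T x : ℝ) / T y - x / y| = x / y * (|p - q| / q) := by
        rw [heq, abs_mul, abs_div, abs_div, abs_of_pos hx, abs_of_pos hy, abs_of_pos hqpos]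
    _ ≤ 1 * (|p - q| / q) := mul_le_mul_of_nonneg_right hxy1 (by positivity)
    _ ≤ 2 * (D * (x : ℝ) ^ (-δ)) / (c / 2) := by rw [one_mul]; gcongr
    _ = _ := by field_simp; ring

lemma pi_forall_mem {ι X : Type*} [Fintype ι] [MeasurableSpace X] (ν : Measure X)
    [IsProbabilityMeasure ν] (A : Finset ι) (B : Set X) :
    (Measure.pi fun _ : ι => ν) {a | ∀ i ∈ A, a i ∈ B} = ν B ^ A.card := by
  classical
  have : {a : ι → X | ∀ i ∈ A, a i ∈ B} = Set.univ.pi fun i => if i ∈ A then B else Set.univ := by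
    ext a
    simp only [Set.mem_ofPred_eq, Set.mem_pi, Set.mem_univ, true_imp_iff]
    refine forall_congr' fun i => ?_
    by_cases hi : i ∈ A <;> simp [hi]
  rw [this, Measure.pi_pi]
  simp_rw [apply_ite ν, measure_univ]
  rw [Finset.prod_ite_mem, Finset.univ_inter, Finset.prod_const]

/-- Under the Pareto law `z ^ (-α)` is uniform, and `1 - s ≤ exp (-s)`. -/
lemma paretoLaw_le_rpow {α s : ℝ} (hα : 0 < α) (hs : 0 ≤ s) :
    paretoLaw α {z | s ≤ (z : ℝ) ^ (-α)} ≤ ENNReal.ofReal (Real.exp (-s)) := by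
  rw [paretoLaw, Measure.map_apply (measurable_paretoOfUniform α)
    (measurableSet_le measurable_const (by fun_prop))]
  have : unitUniform (paretoOfUniform α ⁻¹' {z | s ≤ (z : ℝ) ^ (-α)}) =
      unitUniform (Set.Ici s) := by
    refine measure_congr (eventuallyEq_set.2 ?_)
    filter_upwards [ae_unitUniform_mem] with u hu
    simp [paretoOfUniform_rpow hα hu.1]
  rw [this, unitUniform_Ici hs]
  exact ENNReal.ofReal_le_ofReal (by linarith [Real.add_one_le_exp (-s)])

lemma ae_secondLargest_pos (α : ℝ) {m : ℕ} (hm : 2 ≤ m) :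
    ∀ᵐ a ∂Measure.pi fun _ : Fin m => paretoLaw α, 0 < secondLargest a := by
  filter_upwards [ae_pi_paretoLaw_pos α m] with a ha
  by_contra h
  obtain ⟨j, hj⟩ := (secondLargest_le_iff (by omega) a 0).1 (not_lt.1 h)
  have : Nontrivial (Fin m) := Fin.nontrivial_iff_two_le.2 hm
  obtain ⟨i, hi⟩ := exists_ne j
  exact absurd (ha i) (not_lt.2 (hj i hi))

/-- If the second largest value is small, all values but one are. Of two disjoint blocks of `m / 2`
indices, one misses the exceptional index and so consists of small values only; the factor `2`
counts the blocks. -/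
lemma pi_paretoLaw_le_secondLargest_rpow {α s : ℝ} (hα : 0 < α) (hs : 0 ≤ s) {m : ℕ}
    (hm : 2 ≤ m) :
    (Measure.pi fun _ : Fin m => paretoLaw α) {a | s ≤ (secondLargest a : ℝ) ^ (-α)} ≤
      ENNReal.ofReal (2 * Real.exp (-(((m / 2 : ℕ) : ℝ) * s))) := by
  classical
  set k := m / 2 with hk
  set B : Set ℝ≥0 := {z | s ≤ (z : ℝ) ^ (-α)} with hB
  set A₁ : Finset (Fin m) := (Finset.range k).attachFin (fun i hi => by
    have := Finset.mem_range.1 hi; omega) with hA₁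
  set A₂ : Finset (Fin m) := (Finset.Ico k (2 * k)).attachFin (fun i hi => by
    have := Finset.mem_Ico.1 hi; omega) with hA₂
  have hbound : ∀ A : Finset (Fin m), A.card = k →
      (Measure.pi fun _ : Fin m => paretoLaw α) {a | ∀ i ∈ A, a i ∈ B} ≤
        ENNReal.ofReal (Real.exp (-(k * s))) := by
    intro A hA
    rw [pi_forall_mem, hA]
    refine (pow_le_pow_left₀ (zero_le) (paretoLaw_le_rpow hα hs) k).trans ?_
    rw [← ENNReal.ofReal_pow (Real.exp_pos _).le, ← Real.exp_nat_mul, mul_neg]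
  have hsub : ∀ᵐ a ∂Measure.pi fun _ : Fin m => paretoLaw α,
      a ∈ {a | s ≤ (secondLargest a : ℝ) ^ (-α)} →
        a ∈ {a : Fin m → ℝ≥0 | ∀ i ∈ A₁, a i ∈ B} ∪ {a | ∀ i ∈ A₂, a i ∈ B} := by
    filter_upwards [ae_pi_paretoLaw_pos α m] with a ha has
    obtain ⟨j, hj⟩ := (secondLargest_le_iff (by omega) a _).1 le_rfl
    have hmem : ∀ i, i ≠ j → a i ∈ B := fun i hi =>
      le_trans has (Real.rpow_le_rpow_of_nonpos (NNReal.coe_pos.2 (ha i))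
        (NNReal.coe_le_coe.2 (hj i hi)) (by linarith))
    by_cases hjA : j ∈ A₁
    · refine Or.inr fun i hi => hmem i ?_
      rintro rfl
      simp [hA₁, hA₂, Finset.mem_attachFin] at hjA hi
      omega
    · exact Or.inl fun i hi => hmem i (by rintro rfl; exact hjA hi)
  calc _ ≤ (Measure.pi fun _ : Fin m => paretoLaw α)
        ({a : Fin m → ℝ≥0 | ∀ i ∈ A₁, a i ∈ B} ∪ {a | ∀ i ∈ A₂, a i ∈ B}) :=
        measure_mono_ae hsub
    _ ≤ _ := measure_union_le _ _
    _ ≤ ENNReal.ofReal (Real.exp (-(k * s))) + ENNReal.ofReal (Real.exp (-(k * s))) :=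
        add_le_add (hbound A₁ (by simp [hA₁])) (hbound A₂ (by simp [hA₂]; omega))
    _ = _ := by
        rw [← ENNReal.ofReal_add (Real.exp_pos _).le (Real.exp_pos _).le, two_mul]

/-- Layer-cake formula for the power `δ / α` of `secondLargest a ^ (-α)`: the exponential tail bound
turns it into a Gamma integral, of order `m ^ (-(δ / α))`. -/
lemma lintegral_secondLargest_rpow_le {α δ : ℝ} (hα : 0 < α) (hδ : 0 < δ) {m : ℕ} (hm : 2 ≤ m) :
    ∫⁻ a, ENNReal.ofReal ((secondLargest a : ℝ) ^ (-δ)) ∂(Measure.pi fun _ : Fin m => paretoLaw α)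
      ≤ ENNReal.ofReal (2 * (δ / α) * Real.Gamma (δ / α) * ((m / 2 : ℕ) : ℝ) ^ (-(δ / α))) := by
  set k := m / 2 with hk
  have hk0 : (0 : ℝ) < k := by
    have : 0 < k := by omega
    exact_mod_cast this
  set ζ := δ / α with hζ
  have hζ0 : 0 < ζ := div_pos hδ hα
  have h1 : ∀ a : Fin m → ℝ≥0, (secondLargest a : ℝ) ^ (-δ) =
      ((secondLargest a : ℝ) ^ (-α)) ^ ζ := by
    intro a
    rw [← Real.rpow_mul (NNReal.coe_nonneg _), hζ]
    congr 1
    field_simp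
  simp_rw [h1]
  rw [lintegral_rpow_eq_lintegral_meas_lt_mul _ (ae_of_all _ fun a => by positivity)
    (by fun_prop) hζ0]
  have hG := Real.integral_rpow_mul_exp_neg_mul_Ioi hζ0 hk0
  -- A non-integrable function would have integral `0` by convention, whereas the value in `hG` is
  -- positive.
  have hint : IntegrableOn (fun t : ℝ => t ^ (ζ - 1) * Real.exp (-(k * t))) (Set.Ioi 0) := by
    refine not_imp_comm.1 integral_undef ?_
    rw [hG]
    have := Real.Gamma_pos_of_pos hζ0
    positivity
  calc _ ≤ ENNReal.ofReal ζ * ∫⁻ t in Set.Ioi (0 : ℝ),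
        ENNReal.ofReal (2 * (t ^ (ζ - 1) * Real.exp (-(k * t)))) := by
        refine mul_le_mul_right (setLIntegral_mono' measurableSet_Ioi fun t ht => ?_) _
        have ht0 : (0 : ℝ) < t := ht
        have hlt : (Measure.pi fun _ : Fin m => paretoLaw α)
            {a | t < (secondLargest a : ℝ) ^ (-α)} ≤ _ :=
          (measure_mono (Set.ofPred_subset_ofPred.2 fun _ => le_of_lt)).trans
            (pi_paretoLaw_le_secondLargest_rpow hα ht0.le hm)
        refine (mul_le_mul_left hlt _).trans (le_of_eq ?_)
        rw [← ENNReal.ofReal_mul (by positivity)]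
        congr 1
        ring
    _ = _ := by
        rw [← ofReal_integral_eq_lintegral_ofReal (hint.const_mul 2), ← ENNReal.ofReal_mul hζ0.le,
          integral_const_mul, hG, one_div, Real.inv_rpow hk0.le, Real.rpow_neg hk0.le]
        · congr 1; ring
        · filter_upwards [ae_restrict_mem measurableSet_Ioi] with t ht
          have ht0 : (0 : ℝ) < t := ht
          positivity

/-- Where the second largest value is at least `z₀` the linear expansion applies; elsewhere the
displacement is at most `1`, and that event is exponentially rare in `m`. -/
lemma lintegral_abs_topRatio_comp_sub_le {α : ℝ} (hα : 0 < α) {m : ℕ} (hm : 2 ≤ m)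
    {T : ℝ≥0 → ℝ≥0} (hT : Monotone T) (hT0 : T 0 = 0)
    {c D δ : ℝ} {z₀ : ℝ≥0} (hc : 0 < c) (hD : 0 ≤ D) (hδ : 0 < δ) (hz₀ : 0 < z₀)
    (hlin : ∀ z, z₀ ≤ z → |(T z / z : ℝ) - c| ≤ D * (z : ℝ) ^ (-δ))
    (hlow : ∀ z, z₀ ≤ z → c / 2 ≤ (T z / z : ℝ)) :
    ∫⁻ a, ENNReal.ofReal |topRatio (fun i => T (a i)) - topRatio a|
        ∂(Measure.pi fun _ : Fin m => paretoLaw α) ≤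
      ENNReal.ofReal (4 * D / c * (2 * (δ / α) * Real.Gamma (δ / α) *
          ((m / 2 : ℕ) : ℝ) ^ (-(δ / α))) +
        2 * Real.exp (-(((m / 2 : ℕ) : ℝ) * (z₀ : ℝ) ^ (-α)))) := by
  have hΓ := Real.Gamma_pos_of_pos (div_pos hδ hα)
  set S : Set (Fin m → ℝ≥0) := {a | (z₀ : ℝ) ^ (-α) ≤ (secondLargest a : ℝ) ^ (-α)} with hS
  have hSm : MeasurableSet S := measurableSet_le measurable_const (by fun_prop)
  calc _ ≤ ∫⁻ a, (ENNReal.ofReal (4 * D / c) * ENNReal.ofReal ((secondLargest a : ℝ) ^ (-δ)) +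
        S.indicator 1 a) ∂(Measure.pi fun _ : Fin m => paretoLaw α) := by
        refine lintegral_mono_ae ?_
        filter_upwards [ae_secondLargest_pos α hm] with a ha
        rcases le_or_gt z₀ (secondLargest a) with h | h
        · rw [← ENNReal.ofReal_mul (by positivity)]
          exact le_add_right (ENNReal.ofReal_le_ofReal
            (abs_topRatio_comp_sub_le hT hT0 hc hD hδ hz₀ hlin hlow a h))
        · have haS : a ∈ S := Real.rpow_le_rpow_of_nonpos (NNReal.coe_pos.2 ha)
            (NNReal.coe_le_coe.2 h.le) (by linarith)
          rw [Set.indicator_of_mem haS]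
          refine le_add_left ?_
          rw [Pi.one_apply, ← ENNReal.ofReal_one]
          refine ENNReal.ofReal_le_ofReal (abs_sub_le_iff.2 ⟨?_, ?_⟩)
          · linarith [topRatio_le_one fun i => T (a i), topRatio_nonneg a]
          · linarith [topRatio_nonneg fun i => T (a i), topRatio_le_one a]
    _ ≤ _ := by
        rw [lintegral_add_right _ (measurable_one.indicator hSm),
          lintegral_const_mul _ (by fun_prop), lintegral_indicator_one hSm,
          ENNReal.ofReal_add (by positivity) (by positivity), ENNReal.ofReal_mul (by positivity)]
        exact add_le_add (mul_le_mul_right (lintegral_secondLargest_rpow_le hα hδ hm) _)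
          (pi_paretoLaw_le_secondLargest_rpow hα (by positivity) hm)

/-! ### The quantile coupling of a law with the Pareto law -/

/-- The monotone map that pushes the Pareto law of index `α` forward to `μ`. -/
noncomputable def paretoQuantile (α : ℝ) (μ : Measure ℝ≥0) (z : ℝ≥0) : ℝ≥0 :=
  sInf {x | (z : ℝ) ^ α * μ.real (Set.Ioi x) ≤ 1}

/-- Right-continuity of the tail; it ensures that the infimum in `paretoQuantile` is attained. -/
lemma measureReal_Ioi_le_of_forall_gt {μ : Measure ℝ≥0} [IsProbabilityMeasure μ] {x : ℝ≥0} {b : ℝ}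
    (h : ∀ y, x < y → μ.real (Set.Ioi y) ≤ b) : μ.real (Set.Ioi x) ≤ b := by
  have hb : 0 ≤ b := measureReal_nonneg.trans (h (x + 1) (lt_add_one x))
  obtain ⟨u, hu, hux, hlim⟩ := exists_seq_strictAnti_tendsto x
  have hU : Set.Ioi x = ⋃ n, Set.Ioi (u n) := by
    ext y
    simp only [Set.mem_Ioi, Set.mem_iUnion]
    exact ⟨fun hy => (hlim.eventually_lt_const hy).exists, fun ⟨n, hn⟩ => (hux n).trans hn⟩
  refine ENNReal.toReal_le_of_le_ofReal hb ?_
  rw [hU, Monotone.measure_iUnion fun i j hij => Set.Ioi_subset_Ioi (hu.antitone hij)]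
  refine iSup_le fun n => ?_
  rw [← ofReal_measureReal]
  exact ENNReal.ofReal_le_ofReal (h _ (hux n))

lemma tendsto_measureReal_Ioi_atTop (μ : Measure ℝ≥0) [IsProbabilityMeasure μ] :
    Tendsto (fun x => μ.real (Set.Ioi x)) atTop (𝓝 0) := by
  have h := (ENNReal.tendsto_toReal (by simp)).comp (tendsto_measure_Iic_atTop μ)
  have h2 : ∀ x, μ.real (Set.Ioi x) = 1 - μ.real (Set.Iic x) := fun x => by
    rw [← Set.compl_Iic, probReal_compl_eq_one_sub measurableSet_Iic]
  simp_rw [h2]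
  simpa [measureReal_def] using h.const_sub 1

lemma paretoQuantile_le_iff {α : ℝ} {μ : Measure ℝ≥0} [IsProbabilityMeasure μ]
    {z x : ℝ≥0} : paretoQuantile α μ z ≤ x ↔ (z : ℝ) ^ α * μ.real (Set.Ioi x) ≤ 1 := by
  refine ⟨fun h => ?_, fun h => csInf_le (OrderBot.bddBelow _) h⟩
  have hne : {x : ℝ≥0 | (z : ℝ) ^ α * μ.real (Set.Ioi x) ≤ 1}.Nonempty := by
    have := (tendsto_measureReal_Ioi_atTop μ).const_mul ((z : ℝ) ^ α)
    rw [mul_zero] at this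
    exact ((this.eventually_lt_const one_pos).exists).imp fun x hx => le_of_lt hx
  rcases (Real.rpow_nonneg (NNReal.coe_nonneg z) α).eq_or_lt with h0 | hpos
  · rw [← h0, zero_mul]; exact zero_le_one
  rw [← le_div_iff₀' hpos]
  refine measureReal_Ioi_le_of_forall_gt fun y hy => ?_
  obtain ⟨w, hw, hwy⟩ := exists_lt_of_csInf_lt hne (h.trans_lt hy)
  have hw' : (z : ℝ) ^ α * μ.real (Set.Ioi w) ≤ 1 := hw
  rw [← le_div_iff₀' hpos] at hw'
  exact (measureReal_mono (Set.Ioi_subset_Ioi hwy.le)).trans hw'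

lemma monotone_paretoQuantile {α : ℝ} (hα : 0 < α) (μ : Measure ℝ≥0) [IsProbabilityMeasure μ] :
    Monotone (paretoQuantile α μ) := fun z w hzw => by
  rw [paretoQuantile_le_iff]
  refine le_trans ?_ (paretoQuantile_le_iff.1 (le_refl (paretoQuantile α μ w)))
  exact mul_le_mul_of_nonneg_right
    (Real.rpow_le_rpow (NNReal.coe_nonneg _) (NNReal.coe_le_coe.2 hzw) hα.le) measureReal_nonneg

lemma paretoQuantile_zero {α : ℝ} (hα : 0 < α) (μ : Measure ℝ≥0) [IsProbabilityMeasure μ] :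
    paretoQuantile α μ 0 = 0 := by
  refine le_antisymm ?_ (zero_le)
  rw [paretoQuantile_le_iff]
  simp [Real.zero_rpow hα.ne']

/-- For `z = u ^ (-1 / α)` one has `z ^ α = u⁻¹`, so the quantile is at most `x` exactly when the
tail of `μ` at `x` is at most the uniform variable `u`. -/
lemma map_paretoQuantile {α : ℝ} (hα : 0 < α) (μ : Measure ℝ≥0) [IsProbabilityMeasure μ] :
    (paretoLaw α).map (paretoQuantile α μ) = μ := by
  have hm : Measurable (paretoQuantile α μ) := (monotone_paretoQuantile hα μ).measurable
  refine Measure.ext_of_Iic _ _ fun x => ?_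
  rw [Measure.map_apply hm measurableSet_Iic, paretoLaw,
    Measure.map_apply (measurable_paretoOfUniform α) (hm measurableSet_Iic)]
  have : unitUniform (paretoOfUniform α ⁻¹' (paretoQuantile α μ ⁻¹' Set.Iic x)) =
      unitUniform (Set.Ici (μ.real (Set.Ioi x))) := by
    refine measure_congr (eventuallyEq_set.2 ?_)
    filter_upwards [ae_unitUniform_mem] with u hu
    have hz : (paretoOfUniform α u : ℝ) ^ α = u⁻¹ := by
      rw [← inv_inv ((paretoOfUniform α u : ℝ) ^ α), ← Real.rpow_neg (NNReal.coe_nonneg _),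
        paretoOfUniform_rpow hα hu.1]
    simp only [Set.mem_preimage, Set.mem_Iic, Set.mem_Ici]
    rw [paretoQuantile_le_iff, hz, inv_mul_le_iff₀ hu.1, mul_one]
  rw [this, unitUniform_Ici measureReal_nonneg, ← Set.compl_Iic,
    probReal_compl_eq_one_sub measurableSet_Iic, sub_sub_cancel, ofReal_measureReal]

lemma tendsto_paretoQuantile_atTop {α : ℝ} (hα : 0 < α) {μ : Measure ℝ≥0} [IsProbabilityMeasure μ]
    (hpos : ∀ x, 0 < μ.real (Set.Ioi x)) : Tendsto (paretoQuantile α μ) atTop atTop := by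
  refine tendsto_atTop.2 fun x => ?_
  have h : Tendsto (fun z : ℝ≥0 => (z : ℝ) ^ α * μ.real (Set.Ioi x)) atTop atTop :=
    ((tendsto_rpow_atTop hα).comp (NNReal.tendsto_coe_atTop.2 tendsto_id)).atTop_mul_const (hpos x)
  filter_upwards [h.eventually_gt_atTop 1] with z hz
  exact le_of_lt (not_le.1 fun hle => absurd (paretoQuantile_le_iff.1 hle) (not_le.2 hz))

lemma measureReal_Ioi_pos_of_tail {α C D δ : ℝ} {μ : Measure ℝ≥0} [IsProbabilityMeasure μ]
    (hC : 0 < C) (hδ : 0 < δ)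
    (htail : ∀ᶠ x : ℝ≥0 in atTop,
      |μ.real (Set.Ioi x) - C * (x : ℝ) ^ (-α)| ≤ D * ((x : ℝ) ^ (-α) * (x : ℝ) ^ (-δ)))
    (x : ℝ≥0) : 0 < μ.real (Set.Ioi x) := by
  have h0 : Tendsto (fun x : ℝ≥0 => D * (x : ℝ) ^ (-δ)) atTop (𝓝 0) := by
    simpa using ((tendsto_rpow_neg_atTop hδ).comp
      (NNReal.tendsto_coe_atTop.2 tendsto_id)).const_mul D
  obtain ⟨y, hy, hDy, hxy, hy0⟩ := (htail.and ((h0.eventually_lt_const hC).and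
    ((eventually_ge_atTop x).and (eventually_gt_atTop 0)))).exists
  refine lt_of_lt_of_le ?_ (measureReal_mono (Set.Ioi_subset_Ioi hxy))
  have hyα : (0 : ℝ) < (y : ℝ) ^ (-α) := Real.rpow_pos_of_pos (NNReal.coe_pos.2 hy0) _
  have := (abs_sub_le_iff.1 hy).2
  nlinarith [mul_lt_mul_of_pos_right hDy hyα]

/-- The quantile `τ` of `z` is squeezed by `z ^ α * μ (τ, ∞) ≤ 1` and by `z ^ α * μ (x, ∞) > 1` for
`x < τ`. Inserting the tail expansion in each gives one of the two bounds. -/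
lemma abs_paretoQuantile_div_rpow_sub_le {α C D δ : ℝ} (hα : 0 < α) {μ : Measure ℝ≥0}
    [IsProbabilityMeasure μ] (hpos : ∀ x, 0 < μ.real (Set.Ioi x))
    (htail : ∀ᶠ x : ℝ≥0 in atTop,
      |μ.real (Set.Ioi x) - C * (x : ℝ) ^ (-α)| ≤ D * ((x : ℝ) ^ (-α) * (x : ℝ) ^ (-δ))) :
    ∀ᶠ z : ℝ≥0 in atTop, |((paretoQuantile α μ z / z : ℝ)) ^ α - C| ≤
      D * (paretoQuantile α μ z : ℝ) ^ (-δ) := by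
  obtain ⟨x₀, hx₀⟩ := eventually_atTop.1 htail
  filter_upwards [(tendsto_paretoQuantile_atTop hα hpos).eventually_gt_atTop (max x₀ 0),
    eventually_gt_atTop 0] with z hz hz0
  set τ := paretoQuantile α μ z with hτ
  have hzα : (0 : ℝ) < (z : ℝ) ^ α := Real.rpow_pos_of_pos (NNReal.coe_pos.2 hz0) _
  have hτ0 : (0 : ℝ) < τ := NNReal.coe_pos.2 ((le_max_right _ _).trans_lt hz)
  have hτα : (0 : ℝ) < (τ : ℝ) ^ α := Real.rpow_pos_of_pos hτ0 _
  rw [Real.div_rpow (NNReal.coe_nonneg _) (NNReal.coe_nonneg _)]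
  refine abs_sub_le_iff.2 ⟨?_, ?_⟩
  · rw [sub_le_iff_le_add, div_le_iff₀ hzα]
    have : (𝓝[<] τ).NeBot := nhdsLT_neBot_of_exists_lt ⟨0, NNReal.coe_pos.1 hτ0⟩
    have hcont : ContinuousAt (fun x : ℝ≥0 => (D * (x : ℝ) ^ (-δ) + C) * (z : ℝ) ^ α) τ := by
      have : ContinuousAt (fun x : ℝ≥0 => (x : ℝ) ^ (-δ)) τ :=
        NNReal.continuous_coe.continuousAt.rpow_const (Or.inl hτ0.ne')
      exact ((this.const_mul D).add_const C).mul_const _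
    have hcont' : ContinuousAt (fun x : ℝ≥0 => (x : ℝ) ^ α) τ :=
      NNReal.continuous_coe.continuousAt.rpow_const (Or.inl hτ0.ne')
    -- As `τ` may be an atom of `μ`, the strict inequality is available only to its left; the bound
    -- at `τ` is the limit as `x ↑ τ`.
    refine le_of_tendsto_of_tendsto (b := 𝓝[<] τ) (hcont'.tendsto.mono_left nhdsWithin_le_nhds)
      (hcont.tendsto.mono_left nhdsWithin_le_nhds) ?_
    filter_upwards [Ioo_mem_nhdsLT hz] with x hx
    have hx0 : (0 : ℝ) < x := NNReal.coe_pos.2 ((le_max_right _ _).trans_lt hx.1)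
    have h1 : 1 < (z : ℝ) ^ α * μ.real (Set.Ioi x) :=
      not_le.1 fun h => absurd (paretoQuantile_le_iff.2 h) (not_le.2 hx.2)
    have h2 := (abs_sub_le_iff.1 (hx₀ x ((le_max_left _ _).trans hx.1.le))).1
    have hxα : (0 : ℝ) < (x : ℝ) ^ α := Real.rpow_pos_of_pos hx0 _
    have hinv : (x : ℝ) ^ α * (x : ℝ) ^ (-α) = 1 := by
      rw [← Real.rpow_add hx0, add_neg_cancel, Real.rpow_zero]
    calc (x : ℝ) ^ α ≤ (x : ℝ) ^ α * ((z : ℝ) ^ α * μ.real (Set.Ioi x)) :=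
          le_mul_of_one_le_right hxα.le h1.le
      _ ≤ (x : ℝ) ^ α * ((z : ℝ) ^ α *
            (D * ((x : ℝ) ^ (-α) * (x : ℝ) ^ (-δ)) + C * (x : ℝ) ^ (-α))) := by
          gcongr; linarith
      _ = ((x : ℝ) ^ α * (x : ℝ) ^ (-α)) * ((D * (x : ℝ) ^ (-δ) + C) * (z : ℝ) ^ α) := by ring
      _ = _ := by rw [hinv, one_mul]
  · rw [sub_le_comm, le_div_iff₀ hzα]
    have h1 : (z : ℝ) ^ α * μ.real (Set.Ioi τ) ≤ 1 := paretoQuantile_le_iff.1 le_rfl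
    have h2 := (abs_sub_le_iff.1 (hx₀ τ ((le_max_left _ _).trans hz.le))).2
    have hinv : (τ : ℝ) ^ α * (τ : ℝ) ^ (-α) = 1 := by
      rw [← Real.rpow_add hτ0, add_neg_cancel, Real.rpow_zero]
    calc (C - D * (τ : ℝ) ^ (-δ)) * (z : ℝ) ^ α
        = ((τ : ℝ) ^ α * (τ : ℝ) ^ (-α)) * ((C - D * (τ : ℝ) ^ (-δ)) * (z : ℝ) ^ α) := by
          rw [hinv, one_mul]
      _ = (τ : ℝ) ^ α * ((z : ℝ) ^ α *
            (C * (τ : ℝ) ^ (-α) - D * ((τ : ℝ) ^ (-α) * (τ : ℝ) ^ (-δ)))) := by ring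
      _ ≤ (τ : ℝ) ^ α * ((z : ℝ) ^ α * μ.real (Set.Ioi τ)) := by gcongr; linarith
      _ ≤ (τ : ℝ) ^ α := mul_le_of_le_one_right hτα.le h1

/-- Taking `α`-th roots is differentiable at `C > 0`, so it preserves the order of the error, and `T
z ≥ (c / 2) * z` turns powers of the quantile into powers of `z`. The error stays proportional to
`D`: for `D = 0` the quantile map is exactly linear beyond `z₀`. -/
lemma exists_paretoQuantile_asymptotically_linear {α C D δ : ℝ} (hα : 0 < α) (hC : 0 < C)
    (hD : 0 ≤ D) (hδ : 0 < δ) {μ : Measure ℝ≥0} [IsProbabilityMeasure μ]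
    (htail : ∀ᶠ x : ℝ≥0 in atTop,
      |μ.real (Set.Ioi x) - C * (x : ℝ) ^ (-α)| ≤ D * ((x : ℝ) ^ (-α) * (x : ℝ) ^ (-δ))) :
    ∃ c > 0, ∃ K ≥ 0, ∃ z₀ : ℝ≥0, 0 < z₀ ∧
      (∀ z, z₀ ≤ z → |(paretoQuantile α μ z / z : ℝ) - c| ≤ (K * D) * (z : ℝ) ^ (-δ)) ∧
      ∀ z, z₀ ≤ z → c / 2 ≤ (paretoQuantile α μ z / z : ℝ) := by
  have hpos := measureReal_Ioi_pos_of_tail hC hδ htail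
  have hbd := abs_paretoQuantile_div_rpow_sub_le hα hpos htail
  have hlimC : Tendsto (fun z : ℝ≥0 => ((paretoQuantile α μ z / z : ℝ)) ^ α) atTop (𝓝 C) := by
    rw [tendsto_iff_norm_sub_tendsto_zero]
    refine squeeze_zero' (Eventually.of_forall fun _ => norm_nonneg _) hbd ?_
    simpa using ((tendsto_rpow_neg_atTop hδ).comp ((NNReal.tendsto_coe_atTop.2 tendsto_id).comp
      (tendsto_paretoQuantile_atTop hα hpos))).const_mul D
  have hroot : ∀ z : ℝ≥0, (((paretoQuantile α μ z / z : ℝ)) ^ α) ^ (1 / α) =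
      (paretoQuantile α μ z / z : ℝ) := fun z => by
    rw [← Real.rpow_mul (by positivity), mul_one_div_cancel hα.ne', Real.rpow_one]
  set c := C ^ (1 / α) with hcdef
  have hc : 0 < c := Real.rpow_pos_of_pos hC _
  have hlimc : Tendsto (fun z : ℝ≥0 => (paretoQuantile α μ z / z : ℝ)) atTop (𝓝 c) := by
    simpa only [hroot] using hlimC.rpow_const (p := 1 / α) (Or.inl hC.ne')
  obtain ⟨K, hK, hKb⟩ := ((Real.hasDerivAt_rpow_const (p := 1 / α)
    (Or.inl hC.ne')).isBigO_sub.comp_tendsto hlimC).exists_pos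
  have hev := (hbd.and ((hKb.bound).and ((hlimc.eventually_const_le (half_lt_self hc)).and
    (eventually_gt_atTop (0 : ℝ≥0)))))
  obtain ⟨z₀, hz₀⟩ := eventually_atTop.1 hev
  refine ⟨c, hc, K * (c / 2) ^ (-δ), by positivity, z₀, (hz₀ z₀ le_rfl).2.2.2, fun z hz => ?_,
    fun z hz => (hz₀ z hz).2.2.1⟩
  obtain ⟨h1, h2, h3, h4⟩ := hz₀ z hz
  simp only [Function.comp_apply, hroot, Real.norm_eq_abs] at h2
  have hz0 : (0 : ℝ) < z := NNReal.coe_pos.2 h4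
  have h5 : (paretoQuantile α μ z : ℝ) ^ (-δ) ≤ (c / 2) ^ (-δ) * (z : ℝ) ^ (-δ) := by
    rw [← Real.mul_rpow (by positivity) hz0.le]
    exact Real.rpow_le_rpow_of_nonpos (by positivity) ((le_div_iff₀ hz0).1 h3) (by linarith)
  calc _ ≤ K * |((paretoQuantile α μ z / z : ℝ)) ^ α - C| := h2
    _ ≤ K * (D * ((c / 2) ^ (-δ) * (z : ℝ) ^ (-δ))) := by gcongr; exact h1.trans (by gcongr)
    _ = _ := by ring

/-! ### Convergence in measure to a constant and in distribution -/

section Convergence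

variable {ι Ω Ω' E F : Type*} {l : Filter ι} [MeasurableSpace Ω] [MeasurableSpace Ω']
  {P : Measure Ω} {P' : Measure Ω'}

lemma MeasureTheory.TendstoInMeasure.comp_continuousAt_const [PseudoMetricSpace E]
    [PseudoMetricSpace F] {X : ι → Ω → E} {c : E} {g : E → F}
    (hX : TendstoInMeasure P X l fun _ => c) (hg : ContinuousAt g c) :
    TendstoInMeasure P (fun i ω => g (X i ω)) l fun _ => g c := by
  rw [tendstoInMeasure_iff_dist] at hX ⊢
  intro ε hε
  obtain ⟨η, hη, h⟩ := Metric.continuousAt_iff.1 hg ε hε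
  refine tendsto_of_tendsto_of_tendsto_of_le_of_le tendsto_const_nhds (hX η hη)
    (fun _ => zero_le) fun i => measure_mono (Set.ofPred_subset_ofPred.2 fun ω hω => ?_)
  by_contra hlt
  exact absurd hω (not_le.2 (h (not_le.1 hlt)))

lemma MeasureTheory.TendstoInMeasure.prodMk_const [PseudoMetricSpace E] [PseudoMetricSpace F]
    {X : ι → Ω → E} {Y : ι → Ω → F} {c : E} {d : F}
    (hX : TendstoInMeasure P X l fun _ => c) (hY : TendstoInMeasure P Y l fun _ => d) :
    TendstoInMeasure P (fun i ω => (X i ω, Y i ω)) l fun _ => (c, d) := by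
  rw [tendstoInMeasure_iff_dist] at hX hY ⊢
  intro ε hε
  refine tendsto_of_tendsto_of_tendsto_of_le_of_le tendsto_const_nhds
    (by simpa using (hX ε hε).add (hY ε hε)) (fun _ => zero_le) fun i =>
      (measure_mono fun ω hω => ?_).trans (measure_union_le _ _)
  exact le_max_iff.1 (show ε ≤ max (dist (X i ω) c) (dist (Y i ω) d) from hω)

lemma tendstoInMeasure_zero_of_lintegral_le {f : ι → Ω → ℝ} {b : ι → ℝ}
    (hf : ∀ i, Measurable (f i))
    (hb : ∀ᶠ i in l, ∫⁻ ω, ENNReal.ofReal |f i ω| ∂P ≤ ENNReal.ofReal (b i))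
    (hlim : Tendsto b l (𝓝 0)) : TendstoInMeasure P f l fun _ => 0 := by
  refine tendstoInMeasure_of_tendsto_eLpNorm one_ne_zero (fun i => (hf i).aestronglyMeasurable)
    aestronglyMeasurable_const ?_
  have h0 : Tendsto (fun i => ENNReal.ofReal (b i)) l (𝓝 0) := by
    simpa using ENNReal.tendsto_ofReal hlim
  refine tendsto_of_tendsto_of_tendsto_of_le_of_le' tendsto_const_nhds h0
    (Eventually.of_forall fun _ => zero_le) ?_
  filter_upwards [hb] with i hi
  rw [eLpNorm_one_eq_lintegral_enorm]
  refine le_trans (le_of_eq (lintegral_congr fun ω => ?_)) hi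
  simp [Real.enorm_eq_ofReal_abs]

/-- Convergence in measure to a constant depends on the individual laws only, so it can be checked
on another probability space. -/
lemma TendstoInMeasure.of_map_eq {X : ι → Ω → ℝ} {X' : ι → Ω' → ℝ} {c : ℝ}
    (hX : ∀ i, Measurable (X i)) (hX' : ∀ i, Measurable (X' i))
    (hmap : ∀ᶠ i in l, P.map (X i) = P'.map (X' i)) (h : TendstoInMeasure P' X' l fun _ => c) :
    TendstoInMeasure P X l fun _ => c := by
  rw [tendstoInMeasure_iff_dist] at h ⊢
  intro ε hε
  refine (h ε hε).congr' ?_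
  filter_upwards [hmap] with i hi
  have hs : MeasurableSet {x : ℝ | ε ≤ dist x c} :=
    measurableSet_le measurable_const (by fun_prop)
  have := congrArg (fun μ : Measure ℝ => μ {x | ε ≤ dist x c}) hi
  simp only [Measure.map_apply (hX i) hs, Measure.map_apply (hX' i) hs] at this
  exact this.symm

variable [IsProbabilityMeasure P] [IsProbabilityMeasure P']

lemma TendstoInDistribution.of_map_eq {X : ι → Ω → ℝ} {X' : ι → Ω' → ℝ} {μ : Measure ℝ}
    [IsProbabilityMeasure μ] (hX : ∀ i, AEMeasurable (X i) P)
    (hmap : ∀ᶠ i in l, P.map (X i) = P'.map (X' i))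
    (h : TendstoInDistribution X' l (id : ℝ → ℝ) (fun _ => P') μ) :
    TendstoInDistribution X l (id : ℝ → ℝ) (fun _ => P) μ where
  forall_aemeasurable := hX
  aemeasurable_limit := h.aemeasurable_limit
  tendsto := by
    refine h.tendsto.congr' ?_
    filter_upwards [hmap] with i hi
    exact Subtype.ext hi.symm

/-- Slutsky's theorem for products. -/
lemma MeasureTheory.TendstoInDistribution.mul_gaussian [l.IsCountablyGenerated] {X W : ι → Ω → ℝ}
    {v : ℝ≥0} {w : ℝ}
    (hX : TendstoInDistribution X l (id : ℝ → ℝ) (fun _ => P) (gaussianReal 0 v))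
    (hW : TendstoInMeasure P W l fun _ => w) (hWm : ∀ i, AEMeasurable (W i) P) :
    TendstoInDistribution (fun i ω => X i ω * W i ω) l (id : ℝ → ℝ) (fun _ => P)
      (gaussianReal 0 (v * (w ^ 2).toNNReal)) := by
  have h := hX.continuous_comp_prodMk_of_tendstoInMeasure_const
    (g := fun x : ℝ × ℝ => x.1 * x.2) (by fun_prop) hW hWm
  refine ⟨h.forall_aemeasurable, aemeasurable_id, ?_⟩
  have hlaw : (gaussianReal 0 v).map (fun x => id x * w) =
      (gaussianReal 0 (v * (w ^ 2).toNNReal)).map id := by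
    rw [Measure.map_id]
    have := gaussianReal_map_mul_const (μ := 0) (v := v) w
    simp only [id, mul_zero] at this ⊢
    rw [this, mul_comm]
    congr 2
    exact NNReal.eq (Real.coe_toNNReal _ (sq_nonneg w)).symm
  exact h.tendsto.trans (le_of_eq (congrArg 𝓝 (Subtype.ext hlaw)))

lemma MeasureTheory.TendstoInDistribution.comp_tendsto {κ : Type*} {k : Filter κ} {u : κ → ι}
    {X : ι → Ω → ℝ} {Z : Ω' → ℝ} (h : TendstoInDistribution X l Z (fun _ => P) P')
    (hu : Tendsto u k l) : TendstoInDistribution (fun j => X (u j)) k Z (fun _ => P) P' :=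
  ⟨fun j => h.forall_aemeasurable (u j), h.aemeasurable_limit, h.tendsto.comp hu⟩

end Convergence

/-! ### Limit theorems for the ratios of exact Pareto variables -/

/-- The average of the first `n` values. -/
noncomputable def initialMean (n : ℕ) (x : ℕ → ℝ) : ℝ := (∑ i ∈ Finset.range n, x i) / n

lemma measurable_initialMean {X : Type*} [MeasurableSpace X] (n : ℕ) {f : X → ℕ → ℝ}
    (hf : ∀ i, Measurable fun x => f x i) : Measurable fun x => initialMean n (f x) := by
  unfold initialMean
  fun_prop

/-- The law of an i.i.d. sequence. -/
noncomputable abbrev iidLaw {X : Type*} [MeasurableSpace X] (μ : Measure X) : Measure (ℕ → X) :=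
  Measure.infinitePi fun _ => μ

lemma iIndepFun_iidLaw {X Y : Type*} [MeasurableSpace X] [MeasurableSpace Y] (μ : Measure X)
    [IsProbabilityMeasure μ] {f : X → Y} (hf : Measurable f) :
    iIndepFun (fun (i : ℕ) (x : ℕ → X) => f (x i)) (iidLaw μ) :=
  iIndepFun_infinitePi fun _ => hf

lemma identDistrib_iidLaw {X Y : Type*} [MeasurableSpace X] [MeasurableSpace Y] (μ : Measure X)
    [IsProbabilityMeasure μ] {f : X → Y} (hf : Measurable f) (i : ℕ) :
    IdentDistrib (fun x : ℕ → X => f (x i)) (fun x => f (x 0)) (iidLaw μ) (iidLaw μ) where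
  aemeasurable_fst := (hf.comp (measurable_pi_apply i)).aemeasurable
  aemeasurable_snd := (hf.comp (measurable_pi_apply 0)).aemeasurable
  map_eq := by
    have : ∀ j : ℕ, (iidLaw μ).map (fun x : ℕ → X => f (x j)) = μ.map f := fun j => by
      conv_rhs => rw [← Measure.infinitePi_map_eval (fun _ : ℕ => μ) j]
      rw [Measure.map_map hf (measurable_pi_apply j)]
      rfl
    rw [this, this]

lemma integral_iidLaw_eval {X : Type*} [MeasurableSpace X] (μ : Measure X)
    [IsProbabilityMeasure μ] {f : X → ℝ} (hf : Measurable f) (i : ℕ) :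
    ∫ x, f (x i) ∂iidLaw μ = ∫ x, f x ∂μ := by
  conv_rhs => rw [← Measure.infinitePi_map_eval (fun _ : ℕ => μ) i]
  rw [integral_map (measurable_pi_apply i).aemeasurable hf.aestronglyMeasurable]

lemma memLp_ratioLaw {α : ℝ} (hα : 0 < α) : MemLp id 2 (ratioLaw α) := by
  refine MemLp.of_bound aestronglyMeasurable_id 1 ?_
  filter_upwards [ae_ratioLaw_mem hα] with x hx
  rw [id, Real.norm_eq_abs, abs_of_nonneg hx.1]
  exact hx.2

lemma tendstoInMeasure_initialMean_pow_ratioLaw {α : ℝ} (hα : 0 < α) (r : ℕ) {n : ℕ → ℕ}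
    (hn : Tendsto n atTop atTop) :
    TendstoInMeasure (iidLaw (ratioLaw α)) (fun N x => initialMean (n N) fun i => x i ^ r) atTop
      fun _ => α / (α + r) := by
  have hmeas : Measurable fun x : ℝ => x ^ r := by fun_prop
  have hint : Integrable (fun x : ℕ → ℝ => x 0 ^ r) (iidLaw (ratioLaw α)) := by
    refine Integrable.of_bound ((measurable_pi_apply 0).pow_const r).aestronglyMeasurable 1 ?_
    have : ∀ᵐ x ∂iidLaw (ratioLaw α), x 0 ∈ Set.Icc (0 : ℝ) 1 := by
      have h := ae_ratioLaw_mem hα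
      rw [← Measure.infinitePi_map_eval (fun _ : ℕ => ratioLaw α) 0] at h
      exact ae_of_ae_map (measurable_pi_apply 0).aemeasurable h
    filter_upwards [this] with x hx
    rw [Real.norm_eq_abs, abs_of_nonneg (pow_nonneg hx.1 _)]
    exact pow_le_one₀ hx.1 hx.2
  have h := strong_law_ae_real (fun (i : ℕ) (x : ℕ → ℝ) => x i ^ r) hint
    (fun i j hij => (iIndepFun_iidLaw (ratioLaw α) hmeas).indepFun hij)
    (identDistrib_iidLaw (ratioLaw α) hmeas)
  rw [integral_iidLaw_eval (ratioLaw α) hmeas 0, integral_pow_ratioLaw hα] at h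
  refine tendstoInMeasure_of_tendsto_ae
    (fun N => (measurable_initialMean _ fun i => by fun_prop).aestronglyMeasurable) ?_
  filter_upwards [h] with x hx using hx.comp hn

lemma variance_ratioLaw {α : ℝ} (hα : 0 < α) :
    Var[fun x : ℕ → ℝ => x 0; iidLaw (ratioLaw α)] = α / ((α + 1) ^ 2 * (α + 2)) := by
  have hlaw : IdentDistrib (fun x : ℕ → ℝ => x 0) id (iidLaw (ratioLaw α)) (ratioLaw α) :=
    ⟨(measurable_pi_apply 0).aemeasurable, by fun_prop, by
      rw [Measure.map_id]; exact Measure.infinitePi_map_eval (fun _ : ℕ => ratioLaw α) 0⟩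
  rw [hlaw.variance_eq, variance_eq_sub (memLp_ratioLaw hα)]
  have h2 := integral_pow_ratioLaw hα 2
  have h1 := integral_pow_ratioLaw hα 1
  simp only [pow_one] at h1
  simp only [Pi.pow_apply, id] at *
  rw [h1, h2]
  push_cast
  field_simp
  ring

lemma tendstoInDistribution_initialMean_ratioLaw {α : ℝ} (hα : 0 < α) {n : ℕ → ℕ}
    (hn : Tendsto n atTop atTop) :
    TendstoInDistribution (fun N (x : ℕ → ℝ) => √(n N : ℝ) * (initialMean (n N) x - α / (α + 1)))
      atTop (id : ℝ → ℝ) (fun _ => iidLaw (ratioLaw α))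
      (gaussianReal 0 (α / ((α + 1) ^ 2 * (α + 2))).toNNReal) := by
  have hlaw : HasLaw (id : ℝ → ℝ)
      (gaussianReal 0 Var[fun x : ℕ → ℝ => x 0; iidLaw (ratioLaw α)].toNNReal)
      (gaussianReal 0 (α / ((α + 1) ^ 2 * (α + 2))).toNNReal) := by
    rw [variance_ratioLaw hα]; exact .id
  have hmem : MemLp (fun x : ℕ → ℝ => x 0) 2 (iidLaw (ratioLaw α)) := by
    have h := memLp_ratioLaw hα
    rw [← Measure.infinitePi_map_eval (fun _ : ℕ => ratioLaw α) 0] at h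
    exact h.comp_of_map (measurable_pi_apply 0).aemeasurable
  have hindep : iIndepFun (fun (i : ℕ) (x : ℕ → ℝ) => x i) (iidLaw (ratioLaw α)) :=
    iIndepFun_iidLaw (ratioLaw α) measurable_id
  have hident : ∀ i : ℕ, IdentDistrib (fun x : ℕ → ℝ => x i) (fun x => x 0)
      (iidLaw (ratioLaw α)) (iidLaw (ratioLaw α)) :=
    identDistrib_iidLaw (ratioLaw α) measurable_id
  have h := tendstoInDistribution_inv_sqrt_mul_sum_sub
    (X := fun (i : ℕ) (x : ℕ → ℝ) => x i) hlaw hmem hindep hident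
  have hmean : ∫ x : ℕ → ℝ, x 0 ∂iidLaw (ratioLaw α) = α / (α + 1) := by
    refine (integral_iidLaw_eval (ratioLaw α) measurable_id 0).trans ?_
    simpa using integral_pow_ratioLaw hα 1
  have heq : ∀ (N : ℕ) (x : ℕ → ℝ), √(N : ℝ) * (initialMean N x - α / (α + 1)) =
      (√(N : ℝ))⁻¹ * (∑ k ∈ Finset.range N, x k - N * ∫ x : ℕ → ℝ, x 0 ∂iidLaw (ratioLaw α))
      := by
    intro N x
    rw [hmean, initialMean]
    rcases Nat.eq_zero_or_pos N with rfl | hN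
    · simp
    · have hN' : (0 : ℝ) < N := by exact_mod_cast hN
      rw [eq_inv_mul_iff_mul_eq₀ (Real.sqrt_pos.2 hN').ne', ← mul_assoc, Real.mul_self_sqrt hN'.le]
      field_simp
  have h' : TendstoInDistribution (fun (N : ℕ) (x : ℕ → ℝ) =>
      √(N : ℝ) * (initialMean N x - α / (α + 1))) atTop (id : ℝ → ℝ)
      (fun _ => iidLaw (ratioLaw α)) (gaussianReal 0 (α / ((α + 1) ^ 2 * (α + 2))).toNNReal) := by
    simp_rw [heq]
    exact h
  exact h'.comp_tendsto hn

/-! ### Groups of independent variables -/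

lemma injective_group {m : ℕ} : Function.Injective fun p : ℕ × Fin m => p.1 * m + p.2 := by
  rintro ⟨i, j⟩ ⟨i', j'⟩ h
  have hm : 0 < m := j.pos
  have h1 : i * m + j = i' * m + j' := h
  have hi : i = i' := by
    have := congrArg (· / m) h1
    simpa [Nat.add_comm (_ * m), Nat.add_mul_div_right _ _ hm, Nat.div_eq_of_lt j.2,
      Nat.div_eq_of_lt j'.2] using this
  subst hi
  have hj : j = j' := Fin.ext (by omega)
  rw [hj]

lemma map_group_iidLaw {X : Type*} [MeasurableSpace X] (μ : Measure X) [IsProbabilityMeasure μ]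
    (m i : ℕ) : (iidLaw μ).map (fun z (j : Fin m) => z (i * m + j)) =
      Measure.pi fun _ : Fin m => μ := by
  have hinj : Function.Injective fun j : Fin m => i * m + (j : ℕ) := fun j j' h => by
    have := injective_group (a₁ := (i, j)) (a₂ := (i, j')) h
    exact (Prod.mk.inj this).2
  exact (Measure.map_infinitePi_infinitePi_of_inj (P := fun _ : ℕ => μ) hinj).trans
    (Measure.infinitePi_eq_pi _)

/-- Reindexing by group and position splits the sequence into i.i.d. groups. The resulting law does
not depend on `m`, so the triangular array of ratios reduces to one fixed i.i.d. sequence and the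
classical limit theorems apply. -/
lemma map_kappa_iidLaw_paretoLaw {α : ℝ} (hα : 0 < α) {m : ℕ} (hm : 2 ≤ m) :
    (iidLaw (paretoLaw α)).map (fun z i => kappa z m i) = iidLaw (ratioLaw α) := by
  have h1 : (iidLaw (paretoLaw α)).map (fun z (p : ℕ × Fin m) => z (p.1 * m + p.2)) =
      Measure.infinitePi fun _ : ℕ × Fin m => paretoLaw α :=
    Measure.map_infinitePi_infinitePi_of_inj (P := fun _ : ℕ => paretoLaw α) injective_group
  have h2 := Measure.infinitePi_map_curry (fun (_ : ℕ) (_ : Fin m) => paretoLaw α)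
  have h3 : (Measure.infinitePi fun _ : ℕ => Measure.infinitePi fun _ : Fin m => paretoLaw α).map
      (fun x i => topRatio (x i)) = Measure.infinitePi fun _ : ℕ => ratioLaw α := by
    simp only [Measure.infinitePi_eq_pi (fun _ : Fin m => paretoLaw α)]
    rw [Measure.infinitePi_map_pi _ fun _ => measurable_topRatio, map_topRatio_pi_paretoLaw hα hm]
  have hm1 : Measurable fun (z : ℕ → ℝ≥0) (p : ℕ × Fin m) => z (p.1 * m + p.2) :=
    measurable_pi_lambda _ fun p => measurable_pi_apply _
  have hm3 : Measurable fun (x : ℕ → Fin m → ℝ≥0) (i : ℕ) => topRatio (x i) :=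
    measurable_pi_lambda _ fun i => measurable_topRatio.comp (measurable_pi_apply i)
  rw [iidLaw, iidLaw, ← h3, ← h2, ← h1, Measure.map_map (by fun_prop) hm1,
    Measure.map_map hm3 ((MeasurableEquiv.measurable _).comp hm1)]
  rfl

section Pareto

variable {α : ℝ} {n m : ℕ → ℕ}

lemma map_comp_kappa_iidLaw_paretoLaw (hα : 0 < α) {k : ℕ} (hk : 2 ≤ k) {F : (ℕ → ℝ) → ℝ}
    (hF : Measurable F) : (iidLaw (paretoLaw α)).map (fun z => F fun i => kappa z k i) =
      (iidLaw (ratioLaw α)).map F := by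
  rw [← map_kappa_iidLaw_paretoLaw hα hk,
    Measure.map_map hF (measurable_pi_lambda _ fun i => measurable_kappa k i)]
  rfl

lemma tendstoInMeasure_initialMean_kappa_pow (hα : 0 < α) (r : ℕ) (hn : Tendsto n atTop atTop)
    (hm : Tendsto m atTop atTop) :
    TendstoInMeasure (iidLaw (paretoLaw α))
      (fun N z => initialMean (n N) fun i => kappa z (m N) i ^ r) atTop fun _ => α / (α + r) := by
  have hmeas : ∀ k : ℕ, Measurable fun x : ℕ → ℝ => initialMean k fun i => x i ^ r := fun k =>
    measurable_initialMean _ fun i => (measurable_pi_apply i).pow_const r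
  refine TendstoInMeasure.of_map_eq (fun N => measurable_initialMean _ fun i =>
    (measurable_kappa _ i).pow_const r) (fun N => hmeas (n N)) ?_
    (tendstoInMeasure_initialMean_pow_ratioLaw hα r hn)
  filter_upwards [hm.eventually_ge_atTop 2] with N hN
  exact map_comp_kappa_iidLaw_paretoLaw hα hN (hmeas (n N))

lemma tendstoInDistribution_initialMean_kappa (hα : 0 < α) (hn : Tendsto n atTop atTop)
    (hm : Tendsto m atTop atTop) :
    TendstoInDistribution
      (fun N z => √(n N : ℝ) * (initialMean (n N) (fun i => kappa z (m N) i) - α / (α + 1)))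
      atTop (id : ℝ → ℝ) (fun _ => iidLaw (paretoLaw α))
      (gaussianReal 0 (α / ((α + 1) ^ 2 * (α + 2))).toNNReal) := by
  have hmeas : ∀ k : ℕ, Measurable fun x : ℕ → ℝ =>
      √(k : ℝ) * (initialMean k x - α / (α + 1)) := fun k =>
    ((measurable_initialMean k fun i => measurable_pi_apply i).sub_const _).const_mul _
  refine TendstoInDistribution.of_map_eq (fun N => (((measurable_initialMean _ fun i =>
    measurable_kappa _ i).sub_const _).const_mul _).aemeasurable) ?_
    (tendstoInDistribution_initialMean_ratioLaw hα hn)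
  filter_upwards [hm.eventually_ge_atTop 2] with N hN
  exact map_comp_kappa_iidLaw_paretoLaw hα hN (hmeas (n N))

/-! ### Perturbation of the exact Pareto variables -/

variable {T : ℝ≥0 → ℝ≥0} {b : ℕ → ℝ}

lemma lintegral_initialMean_abs_kappa_sub_le (hT : Measurable T) {k p : ℕ} {c : ℝ}
    (h : ∫⁻ a, ENNReal.ofReal |topRatio (fun i => T (a i)) - topRatio a|
      ∂(Measure.pi fun _ : Fin p => paretoLaw α) ≤ ENNReal.ofReal c) :
    ∫⁻ z, ENNReal.ofReal (initialMean k fun i => |kappa (fun j => T (z j)) p i - kappa z p i|)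
      ∂iidLaw (paretoLaw α) ≤ ENNReal.ofReal c := by
  have hTz : Measurable fun (z : ℕ → ℝ≥0) j => T (z j) :=
    measurable_pi_lambda _ fun j => hT.comp (measurable_pi_apply j)
  have hTa : Measurable fun (a : Fin p → ℝ≥0) j => T (a j) :=
    measurable_pi_lambda _ fun j => hT.comp (measurable_pi_apply j)
  have hi : ∀ i, ∫⁻ z, ENNReal.ofReal |kappa (fun j => T (z j)) p i - kappa z p i|
      ∂iidLaw (paretoLaw α) ≤ ENNReal.ofReal c := by
    intro i
    rw [← map_group_iidLaw (paretoLaw α) p i, lintegral_map] at h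
    · exact h
    · exact (measurable_norm.comp ((measurable_topRatio.comp hTa).sub
        measurable_topRatio)).ennreal_ofReal
    · exact measurable_pi_lambda _ fun j => measurable_pi_apply _
  have hmeas : ∀ i, Measurable fun z : ℕ → ℝ≥0 =>
      ENNReal.ofReal |kappa (fun j => T (z j)) p i - kappa z p i| := fun i =>
    (measurable_norm.comp (((measurable_kappa p i).comp hTz).sub
      (measurable_kappa p i))).ennreal_ofReal
  rcases Nat.eq_zero_or_pos k with rfl | hk
  · simp [initialMean]
  have hk' : (0 : ℝ) < k := by exact_mod_cast hk
  simp_rw [initialMean, ENNReal.ofReal_div_of_pos hk',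
    ENNReal.ofReal_sum_of_nonneg fun i _ => abs_nonneg _, div_eq_mul_inv]
  rw [lintegral_mul_const _ (Finset.measurable_sum _ fun i _ => hmeas i),
    lintegral_finsetSum _ fun i _ => hmeas i, ← div_eq_mul_inv]
  refine ENNReal.div_le_of_le_mul ?_
  refine (Finset.sum_le_sum fun i _ => hi i).trans (le_of_eq ?_)
  rw [Finset.sum_const, Finset.card_range, nsmul_eq_mul, mul_comm, ENNReal.ofReal_natCast]

lemma initialMean_mono {k : ℕ} {x y : ℕ → ℝ} (h : ∀ i, x i ≤ y i) :
    initialMean k x ≤ initialMean k y :=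
  div_le_div_of_nonneg_right (Finset.sum_le_sum fun i _ => h i) (Nat.cast_nonneg _)

lemma abs_initialMean_sub_le {k : ℕ} (x y : ℕ → ℝ) :
    |initialMean k x - initialMean k y| ≤ initialMean k fun i => |x i - y i| := by
  rw [initialMean, initialMean, ← sub_div, ← Finset.sum_sub_distrib, abs_div, Nat.abs_cast]
  exact div_le_div_of_nonneg_right (Finset.abs_sum_le_sum_abs _ _) (Nat.cast_nonneg _)

lemma kappa_nonneg (y : ℕ → ℝ≥0) (m i : ℕ) : 0 ≤ kappa y m i := topRatio_nonneg _

lemma kappa_le_one (y : ℕ → ℝ≥0) (m i : ℕ) : kappa y m i ≤ 1 := topRatio_le_one _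

lemma tendstoInMeasure_sqrt_mul_initialMean_abs_sub (hT : Measurable T)
    (hb : ∀ᶠ N in atTop, ∫⁻ a, ENNReal.ofReal |topRatio (fun i => T (a i)) - topRatio a|
      ∂(Measure.pi fun _ : Fin (m N) => paretoLaw α) ≤ ENNReal.ofReal (b N))
    (hlim : Tendsto (fun N => √(n N : ℝ) * b N) atTop (𝓝 0)) :
    TendstoInMeasure (iidLaw (paretoLaw α)) (fun N z => √(n N : ℝ) * initialMean (n N)
      fun i => |kappa (fun j => T (z j)) (m N) i - kappa z (m N) i|) atTop fun _ => 0 := by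
  have hTz : Measurable fun (z : ℕ → ℝ≥0) j => T (z j) :=
    measurable_pi_lambda _ fun j => hT.comp (measurable_pi_apply j)
  refine tendstoInMeasure_zero_of_lintegral_le (fun N => (measurable_initialMean _ fun i =>
    measurable_norm.comp (((measurable_kappa _ i).comp hTz).sub (measurable_kappa _ i))).const_mul
      _) ?_ hlim
  filter_upwards [hb] with N hN
  have h0 : ∀ z : ℕ → ℝ≥0, 0 ≤ initialMean (n N)
      fun i => |kappa (fun j => T (z j)) (m N) i - kappa z (m N) i| := fun z =>
    div_nonneg (Finset.sum_nonneg fun i _ => abs_nonneg _) (Nat.cast_nonneg _)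
  simp_rw [abs_mul, abs_of_nonneg (Real.sqrt_nonneg _), abs_of_nonneg (h0 _),
    ENNReal.ofReal_mul (Real.sqrt_nonneg _)]
  rw [lintegral_const_mul' _ _ ENNReal.ofReal_ne_top]
  exact mul_le_mul_right (lintegral_initialMean_abs_kappa_sub_le hT hN) _

lemma MeasureTheory.TendstoInMeasure.of_abs_sub_le {Ω : Type*} [MeasurableSpace Ω] {P : Measure Ω}
    {X Y D : ℕ → Ω → ℝ} {c : ℝ} (hX : TendstoInMeasure P X atTop fun _ => c)
    (hD : TendstoInMeasure P D atTop fun _ => 0)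
    (h : ∀ᶠ N in atTop, ∀ ω, |Y N ω - X N ω| ≤ D N ω) :
    TendstoInMeasure P Y atTop fun _ => c := by
  rw [tendstoInMeasure_iff_dist] at hX hD ⊢
  intro ε hε
  refine tendsto_of_tendsto_of_tendsto_of_le_of_le' tendsto_const_nhds
    (by simpa only [add_zero] using (hX (ε / 2) (half_pos hε)).add (hD (ε / 2) (half_pos hε)))
    (Eventually.of_forall fun _ => zero_le) ?_
  filter_upwards [h] with N hN
  refine (measure_mono fun ω hω => ?_).trans (measure_union_le _ _)
  by_contra hn
  rw [Set.mem_union, not_or] at hn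
  have h2 : dist (X N ω) c < ε / 2 := not_le.1 hn.1
  have h3 : dist (D N ω) 0 < ε / 2 := not_le.1 hn.2
  have h4 : ε ≤ dist (Y N ω) c := hω
  have h5 := dist_triangle (Y N ω) (X N ω) c
  rw [Real.dist_eq (Y N ω) (X N ω)] at h5
  rw [Real.dist_eq, sub_zero] at h3
  linarith [hN ω, le_abs_self (D N ω)]

lemma tendstoInMeasure_initialMean_kappa_comp_pow (hα : 0 < α) {r : ℕ} (hr : r = 1 ∨ r = 2)
    (hn : Tendsto n atTop atTop) (hm : Tendsto m atTop atTop) (hT : Measurable T)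
    (hb : ∀ᶠ N in atTop, ∫⁻ a, ENNReal.ofReal |topRatio (fun i => T (a i)) - topRatio a|
      ∂(Measure.pi fun _ : Fin (m N) => paretoLaw α) ≤ ENNReal.ofReal (b N))
    (hlim : Tendsto (fun N => √(n N : ℝ) * b N) atTop (𝓝 0)) :
    TendstoInMeasure (iidLaw (paretoLaw α))
      (fun N z => initialMean (n N) fun i => kappa (fun j => T (z j)) (m N) i ^ r) atTop
      fun _ => α / (α + r) := by
  -- The factor `2` is a Lipschitz constant of `x ^ r` on `[0, 1]` for `r = 1, 2`; the surplus
  -- factor `√n ≥ 1` is harmless.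
  have hD := (tendstoInMeasure_sqrt_mul_initialMean_abs_sub hT hb hlim).comp_continuousAt_const
    (g := fun x => 2 * x) (by fun_prop)
  simp only [mul_zero] at hD
  refine (tendstoInMeasure_initialMean_kappa_pow hα r hn hm).of_abs_sub_le hD ?_
  filter_upwards [hn.eventually_ge_atTop 1] with N hN z
  have h0 : 0 ≤ initialMean (n N)
      fun i => |kappa (fun j => T (z j)) (m N) i - kappa z (m N) i| :=
    div_nonneg (Finset.sum_nonneg fun i _ => abs_nonneg _) (Nat.cast_nonneg _)
  have h1 : 1 ≤ √(n N : ℝ) := by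
    rw [Real.one_le_sqrt]; exact_mod_cast hN
  refine (abs_initialMean_sub_le _ _).trans ?_
  calc _ ≤ initialMean (n N)
        fun i => 2 * |kappa (fun j => T (z j)) (m N) i - kappa z (m N) i| := by
        refine initialMean_mono fun i => ?_
        set x := kappa (fun j => T (z j)) (m N) i
        set y := kappa z (m N) i
        rcases hr with rfl | rfl
        · simp only [pow_one]; linarith [abs_nonneg (x - y)]
        · have hx0 : 0 ≤ x := kappa_nonneg _ _ _
          have hy0 : 0 ≤ y := kappa_nonneg _ _ _
          have hx1 : x ≤ 1 := kappa_le_one _ _ _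
          have hy1 : y ≤ 1 := kappa_le_one _ _ _
          rw [sq_sub_sq, abs_mul, abs_of_nonneg (add_nonneg hx0 hy0)]
          exact mul_le_mul_of_nonneg_right (by linarith) (abs_nonneg _)
    _ = 2 * (1 * initialMean (n N)
        fun i => |kappa (fun j => T (z j)) (m N) i - kappa z (m N) i|) := by
        rw [initialMean, initialMean, ← Finset.mul_sum]; ring
    _ ≤ _ := by gcongr

lemma tendstoInDistribution_initialMean_kappa_comp (hα : 0 < α)
    (hn : Tendsto n atTop atTop) (hm : Tendsto m atTop atTop) (hT : Measurable T)
    (hb : ∀ᶠ N in atTop, ∫⁻ a, ENNReal.ofReal |topRatio (fun i => T (a i)) - topRatio a|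
      ∂(Measure.pi fun _ : Fin (m N) => paretoLaw α) ≤ ENNReal.ofReal (b N))
    (hlim : Tendsto (fun N => √(n N : ℝ) * b N) atTop (𝓝 0)) :
    TendstoInDistribution
      (fun N z => √(n N : ℝ) *
        (initialMean (n N) (fun i => kappa (fun j => T (z j)) (m N) i) - α / (α + 1)))
      atTop (id : ℝ → ℝ) (fun _ => iidLaw (paretoLaw α))
      (gaussianReal 0 (α / ((α + 1) ^ 2 * (α + 2))).toNNReal) := by
  have hTz : Measurable fun (z : ℕ → ℝ≥0) j => T (z j) :=
    measurable_pi_lambda _ fun j => hT.comp (measurable_pi_apply j)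
  refine tendstoInDistribution_of_tendstoInMeasure_sub _ _
    (tendstoInDistribution_initialMean_kappa hα hn hm) ?_ fun N =>
      (((measurable_initialMean _ fun i =>
        (measurable_kappa _ i).comp hTz).sub_const _).const_mul _).aemeasurable
  have h0 : TendstoInMeasure (iidLaw (paretoLaw α)) (fun (_ : ℕ) (_ : ℕ → ℝ≥0) => (0 : ℝ)) atTop
      fun _ => 0 := by
    rw [tendstoInMeasure_iff_dist]
    intro ε hε
    simp [not_le.2 hε]
  refine h0.of_abs_sub_le (tendstoInMeasure_sqrt_mul_initialMean_abs_sub hT hb hlim)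
    (Eventually.of_forall fun N z => ?_)
  rw [sub_zero, Pi.sub_apply, Pi.sub_apply, ← mul_sub, sub_sub_sub_cancel_right, abs_mul,
    abs_of_nonneg (Real.sqrt_nonneg _)]
  exact mul_le_mul_of_nonneg_left (abs_initialMean_sub_le _ _) (Real.sqrt_nonneg _)

end Pareto

/-! ### The estimator of the tail index -/

/-- The factor `g` in `x / (1 - x) - α = (x - α / (α + 1)) * g x`. -/
noncomputable def estimatorSlope (α x : ℝ) : ℝ :=
  if x = 1 then -(α * (α + 1)) else (α + 1) / (1 - x)

/-- An exact factorisation, in place of a Taylor expansion, reduces the delta method to Slutsky's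
theorem. At `x = 1` the convention `1 / 0 = 0` makes the left side `-α`, which dictates the
exceptional value of `estimatorSlope`. -/
lemma div_one_sub_sub {α : ℝ} (hα : 0 < α) (x : ℝ) :
    x / (1 - x) - α = (x - α / (α + 1)) * estimatorSlope α x := by
  unfold estimatorSlope
  split_ifs with h
  · subst h; field_simp; ring
  · have : 1 - x ≠ 0 := sub_ne_zero.2 (Ne.symm h)
    field_simp
    ring

lemma estimatorSlope_limit {α : ℝ} (hα : 0 < α) :
    estimatorSlope α (α / (α + 1)) = (α + 1) ^ 2 := by
  have h : α / (α + 1) ≠ 1 := ((div_lt_one (by positivity)).2 (by linarith)).ne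
  rw [estimatorSlope, if_neg h]
  field_simp
  ring

lemma continuousAt_estimatorSlope {α : ℝ} (hα : 0 < α) :
    ContinuousAt (estimatorSlope α) (α / (α + 1)) := by
  have h : α / (α + 1) ≠ 1 := ((div_lt_one (by positivity)).2 (by linarith)).ne
  have hc : ContinuousAt (fun x : ℝ => (α + 1) / (1 - x)) (α / (α + 1)) :=
    continuousAt_const.div (by fun_prop) (sub_ne_zero.2 h.symm)
  refine hc.congr ?_
  filter_upwards [isOpen_ne.mem_nhds h] with x hx
  exact (if_neg hx).symm

@[fun_prop]
lemma measurable_estimatorSlope (α : ℝ) : Measurable (estimatorSlope α) :=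
  Measurable.ite (measurableSet_singleton 1) measurable_const (by fun_prop)

lemma tendstoInDistribution_estimator {Ω : Type*} [MeasurableSpace Ω] {P : Measure Ω}
    [IsProbabilityMeasure P] {α : ℝ} (hα : 0 < α) {n : ℕ → ℕ} {A B : ℕ → Ω → ℝ}
    (hAm : ∀ N, Measurable (A N)) (hBm : ∀ N, Measurable (B N))
    (hX : TendstoInDistribution (fun N ω => √(n N : ℝ) * (A N ω - α / (α + 1))) atTop
      (id : ℝ → ℝ) (fun _ => P) (gaussianReal 0 (α / ((α + 1) ^ 2 * (α + 2))).toNNReal))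
    (hA : TendstoInMeasure P A atTop fun _ => α / (α + 1))
    (hB : TendstoInMeasure P B atTop fun _ => α / (α + 2)) :
    TendstoInDistribution (fun N ω => √(n N : ℝ) * (A N ω / (1 - A N ω) - α) /
        ((α + 1) ^ 2 * √(B N ω - A N ω ^ 2)))
      atTop (id : ℝ → ℝ) (fun _ => P) (gaussianReal 0 1) ∧
    TendstoInDistribution (fun N ω => √(n N : ℝ) * (A N ω / (1 - A N ω) - α))
      atTop (id : ℝ → ℝ) (fun _ => P)
      (gaussianReal 0 (Real.toNNReal (α * (α + 1) ^ 2 / (α + 2)))) := by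
  set v := α / ((α + 1) ^ 2 * (α + 2)) with hv
  have hv0 : 0 < v := by positivity
  have hvar : α / (α + 2) - (α / (α + 1)) ^ 2 = v := by rw [hv]; field_simp; ring
  constructor
  · have hcont : ContinuousAt (fun x : ℝ × ℝ => estimatorSlope α x.1 /
        ((α + 1) ^ 2 * √(x.2 - x.1 ^ 2))) (α / (α + 1), α / (α + 2)) := by
      refine ContinuousAt.div ?_ (by fun_prop) ?_
      · exact ContinuousAt.comp (f := Prod.fst) (g := estimatorSlope α)
          (continuousAt_estimatorSlope hα) continuousAt_fst
      · simp only [hvar]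
        have := Real.sqrt_pos.2 hv0
        positivity
    have hW := (hA.prodMk_const hB).comp_continuousAt_const hcont
    simp only [hvar, estimatorSlope_limit hα] at hW
    have h := hX.mul_gaussian hW fun N => by
      have := hAm N
      have := hBm N
      fun_prop
    -- The slope and the normalisation converge jointly, and their quotient tends to `1 / √v`, which
    -- standardises the Gaussian limit.
    have hone : v.toNNReal * (((α + 1) ^ 2 / ((α + 1) ^ 2 * √v)) ^ 2).toNNReal = 1 := by
      rw [← Real.toNNReal_mul hv0.le, ← Real.toNNReal_one]
      congr 1
      rw [div_pow, mul_pow, Real.sq_sqrt hv0.le]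
      field_simp
    rw [hone] at h
    refine h.congr (fun N => ae_of_all _ fun ω => ?_) (ae_eq_refl _)
    simp only [div_one_sub_sub hα]
    ring
  · have hW := hA.comp_continuousAt_const (continuousAt_estimatorSlope hα)
    rw [estimatorSlope_limit hα] at hW
    have h := hX.mul_gaussian hW fun N => by
      have := hAm N
      fun_prop
    have hvw : v.toNNReal * (((α + 1) ^ 2) ^ 2).toNNReal =
        Real.toNNReal (α * (α + 1) ^ 2 / (α + 2)) := by
      rw [← Real.toNNReal_mul hv0.le]
      congr 1
      rw [hv]; field_simp
    rw [hvw] at h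
    refine h.congr (fun N => ae_of_all _ fun ω => ?_) (ae_eq_refl _)
    simp only [div_one_sub_sub hα]
    ring

lemma kappaSum_eq_sum (y : ℕ → ℝ≥0) (n m : ℕ) :
    kappaSum y n m = ∑ i ∈ Finset.range n, kappa y m i := rfl

lemma tailIndexEstimator_eq {n : ℕ} (hn : n ≠ 0) (y : ℕ → ℝ≥0) (m : ℕ) :
    tailIndexEstimator y n m =
      initialMean n (kappa y m) / (1 - initialMean n (kappa y m)) := by
  have hn' : (n : ℝ) ≠ 0 := Nat.cast_ne_zero.2 hn
  rw [tailIndexEstimator, kappaSum_eq_sum, initialMean, one_sub_div hn', div_div_div_cancel_right₀ hn']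

lemma kappaVariance_eq (y : ℕ → ℝ≥0) (n m : ℕ) :
    kappaVariance y n m =
      initialMean n (fun i => kappa y m i ^ 2) - initialMean n (kappa y m) ^ 2 := by
  rw [kappaVariance, kappaSum_eq_sum, initialMean, initialMean]
  ring

lemma measurable_tailIndexEstimator (n m : ℕ) :
    Measurable fun y : ℕ → ℝ≥0 => tailIndexEstimator y n m := by
  have h : Measurable fun y : ℕ → ℝ≥0 => kappaSum y n m :=
    Finset.measurable_sum _ fun i _ => measurable_kappa m i
  exact h.div (h.const_sub _)

lemma measurable_kappaVariance (n m : ℕ) :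
    Measurable fun y : ℕ → ℝ≥0 => kappaVariance y n m := by
  simp_rw [kappaVariance_eq]
  exact (measurable_initialMean _ fun i => (measurable_kappa m i).pow_const 2).sub
    ((measurable_initialMean _ fun i => measurable_kappa m i).pow_const 2)

lemma map_iidLaw {X Y : Type*} [MeasurableSpace X] [MeasurableSpace Y] (μ : Measure X)
    [IsProbabilityMeasure μ] {f : X → Y} (hf : Measurable f) :
    (iidLaw μ).map (fun x (i : ℕ) => f (x i)) = iidLaw (μ.map f) :=
  Measure.infinitePi_map_pi (fun _ : ℕ => μ) fun _ => hf

theorem tendstoInDistribution_tailIndexEstimator {Ω : Type*} [MeasurableSpace Ω] {P : Measure Ω}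
    [IsProbabilityMeasure P] {Y : ℕ → Ω → ℝ≥0} (hY : ∀ i, Measurable (Y i))
    (hindep : iIndepFun Y P) (hident : ∀ i, IdentDistrib (Y i) (Y 0) P P)
    {α C D δ : ℝ} (hα : 0 < α) (hC : 0 < C) (hD : 0 ≤ D) (hδ : 0 < δ)
    (htail : ∀ᶠ x : ℝ≥0 in atTop,
      |P.real {ω | x < Y 0 ω} - C * (x : ℝ) ^ (-α)| ≤ D * ((x : ℝ) ^ (-α) * (x : ℝ) ^ (-δ)))
    {n m : ℕ → ℕ} (hn : Tendsto n atTop atTop) (hm : Tendsto m atTop atTop)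
    (hbias : Tendsto (fun N => √(n N : ℝ) * (D * ((m N / 2 : ℕ) : ℝ) ^ (-(δ / α)))) atTop (𝓝 0))
    (hexp : ∀ s : ℝ, 0 < s →
      Tendsto (fun N => √(n N : ℝ) * Real.exp (-(((m N / 2 : ℕ) : ℝ) * s))) atTop (𝓝 0)) :
    TendstoInDistribution
      (fun N ω => √(n N : ℝ) * (tailIndexEstimator (fun k => Y k ω) (n N) (m N) - α) /
        ((α + 1) ^ 2 * √(kappaVariance (fun k => Y k ω) (n N) (m N))))
      atTop (id : ℝ → ℝ) (fun _ => P) (gaussianReal 0 1) ∧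
    TendstoInDistribution
      (fun N ω => √(n N : ℝ) * (tailIndexEstimator (fun k => Y k ω) (n N) (m N) - α))
      atTop (id : ℝ → ℝ) (fun _ => P)
      (gaussianReal 0 (Real.toNNReal (α * (α + 1) ^ 2 / (α + 2)))) := by
  set μ := P.map (Y 0) with hμ
  have : IsProbabilityMeasure μ := Measure.isProbabilityMeasure_map (hY 0).aemeasurable
  have htail' : ∀ᶠ x : ℝ≥0 in atTop,
      |μ.real (Set.Ioi x) - C * (x : ℝ) ^ (-α)| ≤ D * ((x : ℝ) ^ (-α) * (x : ℝ) ^ (-δ)) := by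
    filter_upwards [htail] with x hx
    rw [hμ, map_measureReal_apply (hY 0) measurableSet_Ioi]
    exact hx
  obtain ⟨c, hc, K, hK, z₀, hz₀, hlin, hlow⟩ :=
    exists_paretoQuantile_asymptotically_linear hα hC hD hδ htail'
  set T := paretoQuantile α μ
  have hTmono : Monotone T := monotone_paretoQuantile hα μ
  have hT : Measurable T := hTmono.measurable
  have hb : ∀ᶠ N in atTop, ∫⁻ a, ENNReal.ofReal |topRatio (fun i => T (a i)) - topRatio a|
      ∂(Measure.pi fun _ : Fin (m N) => paretoLaw α) ≤ _ :=
    (hm.eventually_ge_atTop 2).mono fun N hN => lintegral_abs_topRatio_comp_sub_le hα hN hTmono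
      (paretoQuantile_zero hα μ) hc (mul_nonneg hK hD) hδ hz₀ hlin hlow
  have hlim := ((hbias.const_mul (4 * K / c * (2 * (δ / α) * Real.Gamma (δ / α)))).add
    ((hexp _ (Real.rpow_pos_of_pos (NNReal.coe_pos.2 hz₀) (-α))).const_mul 2))
  rw [mul_zero, mul_zero, add_zero] at hlim
  have hlim' : Tendsto (fun N => √(n N : ℝ) * (4 * (K * D) / c *
      (2 * (δ / α) * Real.Gamma (δ / α) * ((m N / 2 : ℕ) : ℝ) ^ (-(δ / α))) +
        2 * Real.exp (-(((m N / 2 : ℕ) : ℝ) * (z₀ : ℝ) ^ (-α))))) atTop (𝓝 0) :=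
    hlim.congr fun N => by ring
  have hTz : Measurable fun (z : ℕ → ℝ≥0) j => T (z j) :=
    measurable_pi_lambda _ fun j => hT.comp (measurable_pi_apply j)
  have hA := tendstoInMeasure_initialMean_kappa_comp_pow hα (Or.inl rfl) hn hm hT hb hlim'
  have hB := tendstoInMeasure_initialMean_kappa_comp_pow hα (Or.inr rfl) hn hm hT hb hlim'
  simp only [pow_one, Nat.cast_one] at hA
  have key := tendstoInDistribution_estimator hα
    (fun N => measurable_initialMean _ fun i => (measurable_kappa (m N) i).comp hTz)
    (fun N => measurable_initialMean _ fun i => ((measurable_kappa (m N) i).comp hTz).pow_const 2)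
    (tendstoInDistribution_initialMean_kappa_comp hα hn hm hT hb hlim') hA (by exact_mod_cast hB)
  have hYm : Measurable fun ω k => Y k ω := measurable_pi_lambda _ hY
  -- The coupling: as a whole sequence, `Y` has the law of the quantile map applied to i.i.d. Pareto
  -- variables.
  have hlaw : P.map (fun ω k => Y k ω) = (iidLaw (paretoLaw α)).map fun z j => T (z j) := by
    rw [map_iidLaw _ hT, map_paretoQuantile hα μ, hindep.map_fun_eq_infinitePi_map hY]
    simp_rw [fun i => (hident i).map_eq]
    rfl
  have htransfer : ∀ {F G : ℕ → (ℕ → ℝ≥0) → ℝ} {ν : Measure ℝ} [IsProbabilityMeasure ν],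
      (∀ N, Measurable (F N)) → (∀ N, n N ≠ 0 → F N = G N) →
      TendstoInDistribution (fun N z => G N fun j => T (z j)) atTop (id : ℝ → ℝ)
        (fun _ => iidLaw (paretoLaw α)) ν →
      TendstoInDistribution (fun N ω => F N fun k => Y k ω) atTop (id : ℝ → ℝ) (fun _ => P) ν := by
    intro F G ν _ hF hFG hG
    refine TendstoInDistribution.of_map_eq (fun N => ((hF N).comp hYm).aemeasurable) ?_ hG
    filter_upwards [hn.eventually_ne_atTop 0] with N hN
    have h1 : P.map (fun ω => F N fun k => Y k ω) = (P.map fun ω k => Y k ω).map (F N) :=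
      (Measure.map_map (hF N) hYm).symm
    rw [h1, hlaw, Measure.map_map (hF N) hTz, hFG N hN]
    rfl
  have hest : ∀ N, Measurable fun y : ℕ → ℝ≥0 =>
      √(n N : ℝ) * (tailIndexEstimator y (n N) (m N) - α) := fun N =>
    ((measurable_tailIndexEstimator _ _).sub_const _).const_mul _
  refine ⟨htransfer (F := fun N y => √(n N : ℝ) * (tailIndexEstimator y (n N) (m N) - α) /
      ((α + 1) ^ 2 * √(kappaVariance y (n N) (m N))))
      (G := fun N y => √(n N : ℝ) * (initialMean (n N) (kappa y (m N)) /
        (1 - initialMean (n N) (kappa y (m N))) - α) / ((α + 1) ^ 2 *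
          √(initialMean (n N) (fun i => kappa y (m N) i ^ 2) -
            initialMean (n N) (kappa y (m N)) ^ 2)))
      (fun N => ?_) (fun N hN => ?_) key.1,
    htransfer (F := fun N y => √(n N : ℝ) * (tailIndexEstimator y (n N) (m N) - α))
      (G := fun N y => √(n N : ℝ) * (initialMean (n N) (kappa y (m N)) /
        (1 - initialMean (n N) (kappa y (m N))) - α)) hest (fun N hN => ?_) key.2⟩
  · exact (hest N).div (((measurable_kappaVariance _ _).sqrt).const_mul _)
  · funext y
    rw [tailIndexEstimator_eq hN, kappaVariance_eq]
  · funext y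
    rw [tailIndexEstimator_eq hN]

/-! ### The tail of the norm -/

section Tail

variable {K : Type*} [EMetricSpace K] [AddCommMonoid K] [DistribMulAction {a : ℝ // 0 < a} K]
  [NormedCone K]

lemma NormedCone.direction_mem_unitSphere {x : K} (hx : 0 < NormedCone.cnorm x) :
    NormedCone.direction x ∈ NormedCone.unitSphere K := by
  have hx' : 0 < (NormedCone.cnorm x : ℝ) := hx
  have hhom := (Classical.choose_spec (NormedCone.exists_origin (K := K))).2
  rw [NormedCone.direction, dif_pos hx']
  have hfin : edist x (NormedCone.origin K) ≠ ⊤ := fun h => by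
    simp [NormedCone.cnorm, h] at hx
  refine (hhom _ x).trans ?_
  change ENNReal.ofReal (NormedCone.cnorm x : ℝ)⁻¹ * edist x (NormedCone.origin K) = 1
  have h2 : edist x (NormedCone.origin K) = ENNReal.ofReal (NormedCone.cnorm x : ℝ) := by
    rw [ENNReal.ofReal_coe_nnreal, NormedCone.cnorm, ENNReal.coe_toNNReal hfin]
  rw [h2, ← ENNReal.ofReal_mul (by positivity), inv_mul_cancel₀ hx'.ne', ENNReal.ofReal_one]

lemma NormedCone.measurable_cnorm [MeasurableSpace K] [BorelSpace K] :
    Measurable (NormedCone.cnorm : K → ℝ≥0) :=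
  (measurable_id.edist measurable_const).ennreal_toNNReal

variable [MeasurableSpace K] {Ω : Type*} [MeasurableSpace Ω] {P : Measure Ω} {X : Ω → K} {α : ℝ}
  {σ : Measure (NormedCone.unitSphere K)} [IsProbabilityMeasure σ]

/-- Take the whole sphere as the test set: its frontier is empty, its mass is `1`, and the condition
on the direction holds automatically once the norm is positive. -/
lemma RegularlyVaryingTail.exists_slowlyVarying (h : RegularlyVaryingTail P X α σ) :
    ∃ L : ℝ → ℝ, SlowlyVarying L ∧
      Tendsto (fun x : ℝ => x ^ α / L x * P.real {ω | x < NormedCone.cnorm (X ω)}) atTop (𝓝 1) := by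
  obtain ⟨-, L, hL, h⟩ := h
  refine ⟨L, hL, ?_⟩
  have h1 := h Set.univ MeasurableSet.univ (by simp)
  rw [probReal_univ] at h1
  refine h1.congr' ?_
  filter_upwards [eventually_ge_atTop 0] with x hx
  congr 2
  ext ω
  simp only [Set.image_univ, Subtype.range_coe_subtype, Set.mem_ofPred_eq, and_iff_right_iff_imp]
  intro hω
  exact NormedCone.direction_mem_unitSphere (NNReal.coe_pos.1 (hx.trans_lt hω))

end Tail

lemma tendsto_div_two_mul_of_slowlyVarying {G L : ℝ → ℝ} {α : ℝ} (hL : SlowlyVarying L)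
    (h : Tendsto (fun x : ℝ => x ^ α / L x * G x) atTop (𝓝 1)) :
    Tendsto (fun x => G (2 * x) / G x) atTop (𝓝 (2 ^ (-α))) := by
  have h2 := h.comp (tendsto_id.const_mul_atTop (zero_lt_two' ℝ))
  have h3 := ((h2.div h one_ne_zero).mul (hL.2 2 zero_lt_two)).mul_const ((2 : ℝ) ^ (-α))
  simp only [div_one, mul_one, one_mul] at h3
  refine h3.congr' ?_
  filter_upwards [hL.1, (tendsto_id.const_mul_atTop (zero_lt_two' ℝ)).eventually hL.1,
    eventually_gt_atTop 0] with x hx hx2 hx0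
  have hx2' : 0 < L (2 * x) := hx2
  simp only [Function.comp_apply, id, Pi.div_apply]
  rw [Real.mul_rpow zero_le_two hx0.le, Real.rpow_neg zero_le_two]
  have hxα : 0 < x ^ α := Real.rpow_pos_of_pos hx0 _
  have h2α : (0 : ℝ) < 2 ^ α := Real.rpow_pos_of_pos two_pos _
  rcases eq_or_ne (G x) 0 with hG | hG
  · simp [hG]
  · field_simp

/-- A function with a regularly varying tail of index `α` is not `O (x ^ (-b))` for `α < b`. -/
lemma not_isBigO_rpow_of_slowlyVarying {G L : ℝ → ℝ} {α b : ℝ} (hL : SlowlyVarying L)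
    (h : Tendsto (fun x : ℝ => x ^ α / L x * G x) atTop (𝓝 1)) (hb : α < b) :
    ¬ G =O[atTop] fun x : ℝ => x ^ (-b) := by
  intro hO
  -- Along `2 ^ k * x₀` each doubling reduces `G` by a factor greater than `2 ^ (-γ)`, so `G` decays
  -- no faster than `2 ^ (-γ * k)`; since `γ < b`, a bound of order `2 ^ (-b * k)` is impossible.
  obtain ⟨γ, hαγ, hγb⟩ := exists_between hb
  have hpos : ∀ᶠ x in atTop, 0 < G x := by
    filter_upwards [hL.1, h.eventually_const_lt zero_lt_one, eventually_gt_atTop 0] with x h1 h2 h3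
    exact pos_of_mul_pos_right h2 (by positivity)
  have hratio : ∀ᶠ x in atTop, 2 ^ (-γ) < G (2 * x) / G x :=
    (tendsto_div_two_mul_of_slowlyVarying hL h).eventually_const_lt
      (Real.rpow_lt_rpow_of_exponent_lt one_lt_two (by linarith))
  obtain ⟨x₀, hx₀⟩ := eventually_atTop.1 (hpos.and (hratio.and (eventually_gt_atTop 0)))
  have hx₀0 : 0 < x₀ := (hx₀ x₀ le_rfl).2.2
  have hge : ∀ k : ℕ, x₀ ≤ 2 ^ k * x₀ := fun k =>
    le_mul_of_one_le_left hx₀0.le (one_le_pow₀ one_le_two)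
  have hlow : ∀ k : ℕ, ((2 : ℝ) ^ (-γ)) ^ k * G x₀ ≤ G (2 ^ k * x₀) := by
    intro k
    induction k with
    | zero => simp
    | succ k ih =>
      obtain ⟨h1, h2, -⟩ := hx₀ _ (hge k)
      rw [lt_div_iff₀ h1] at h2
      have : (2 : ℝ) ^ (k + 1) * x₀ = 2 * (2 ^ k * x₀) := by ring
      rw [this, pow_succ']
      calc _ = (2 : ℝ) ^ (-γ) * (((2 : ℝ) ^ (-γ)) ^ k * G x₀) := by ring
        _ ≤ (2 : ℝ) ^ (-γ) * G (2 ^ k * x₀) := by gcongr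
        _ ≤ _ := h2.le
  have hseq : Tendsto (fun k : ℕ => (2 : ℝ) ^ k * x₀) atTop atTop :=
    (tendsto_pow_atTop_atTop_of_one_lt one_lt_two).atTop_mul_const hx₀0
  obtain ⟨M, hM, hMb⟩ := hO.exists_pos
  have hbound : ∀ᶠ k : ℕ in atTop, G x₀ ≤ M * x₀ ^ (-b) * ((2 : ℝ) ^ (γ - b)) ^ k := by
    filter_upwards [hseq.eventually hMb.bound] with k hk
    rw [Real.norm_eq_abs, Real.norm_eq_abs, abs_of_pos (hx₀ _ (hge k)).1,
      abs_of_nonneg (by positivity)] at hk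
    have h1 := (hlow k).trans hk
    have h2 : ((2 : ℝ) ^ (k : ℕ) * x₀) ^ (-b) = ((2 : ℝ) ^ (-b)) ^ k * x₀ ^ (-b) := by
      rw [Real.mul_rpow (by positivity) hx₀0.le, ← Real.rpow_natCast, ← Real.rpow_natCast,
        ← Real.rpow_mul zero_le_two, ← Real.rpow_mul zero_le_two, mul_comm (k : ℝ)]
    have h3 : (0 : ℝ) < ((2 : ℝ) ^ (-γ)) ^ k := by positivity
    rw [h2, ← le_div_iff₀' h3] at h1
    refine h1.trans (le_of_eq ?_)
    rw [show γ - b = -b - -γ by ring, Real.rpow_sub two_pos, div_pow]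
    ring
  have hlim : Tendsto (fun k : ℕ => M * x₀ ^ (-b) * ((2 : ℝ) ^ (γ - b)) ^ k) atTop (𝓝 0) := by
    simpa using (tendsto_pow_atTop_nhds_zero_of_lt_one (by positivity)
      (Real.rpow_lt_one_of_one_lt_of_neg one_lt_two (by linarith))).const_mul (M * x₀ ^ (-b))
  exact absurd (ge_of_tendsto hlim hbound) (not_le.2 (hx₀ x₀ le_rfl).1)

/-- The second-order expansion of a regularly varying tail, with a positive leading coefficient;
for `β = ⊤` the remainder vanishes. -/
lemma SecondOrderTail.exists_pos {G L : ℝ → ℝ} {α : ℝ} (hL : SlowlyVarying L)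
    (h : Tendsto (fun x : ℝ => x ^ α / L x * G x) atTop (𝓝 1)) {β : WithTop ℝ}
    (hαβ : (α : WithTop ℝ) < β) (hG : SecondOrderTail G α β) :
    ∃ C > 0, ∃ D ≥ 0, (β = ⊤ → D = 0) ∧ ∀ᶠ x : ℝ in atTop,
      |G x - C * x ^ (-α)| ≤ D * (x ^ (-α) * x ^ (-(β.untopD (α + 1) - α))) := by
  have hpos : ∀ᶠ x in atTop, 0 < G x := by
    filter_upwards [hL.1, h.eventually_const_lt zero_lt_one, eventually_gt_atTop 0] with x h1 h2 h3
    exact pos_of_mul_pos_right h2 (by positivity)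
  induction β with
  | top =>
    obtain ⟨C, hC⟩ := hG
    refine ⟨C, ?_, 0, le_rfl, fun _ => rfl, ?_⟩
    · obtain ⟨x, h1, h2, h3⟩ := (hC.and (hpos.and (eventually_gt_atTop 0))).exists
      rw [h1] at h2
      exact pos_of_mul_pos_left h2 (by positivity)
    · filter_upwards [hC] with x hx
      simp [hx]
  | coe b =>
    have hb : α < b := WithTop.coe_lt_coe.1 hαβ
    obtain ⟨C, C₂, hC⟩ := hG
    have hO : (fun x => G x - C * x ^ (-α)) =O[atTop] fun x : ℝ => x ^ (-b) := by
      have h1 : (fun x : ℝ => C₂ * x ^ (-b)) =O[atTop] fun x : ℝ => x ^ (-b) :=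
        (isBigO_refl _ _).const_mul_left C₂
      refine (hC.isBigO.add h1).congr_left fun x => by ring
    have hsplit : ∀ x : ℝ, 0 < x → x ^ (-b) = x ^ (-α) * x ^ (-(b - α)) := fun x hx => by
      rw [← Real.rpow_add hx]; congr 1; ring
    -- If `C ≤ 0`, then `0 < G x ≤ G x - C * x ^ (-α) = O(x ^ (-b))`, which regular variation of
    -- index `α < b` excludes.
    have hCpos : 0 < C := by
      by_contra hC0
      refine not_isBigO_rpow_of_slowlyVarying hL h hb (IsBigO.trans ?_ hO)
      refine IsBigO.of_bound 1 ?_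
      filter_upwards [hpos, eventually_gt_atTop 0] with x hx hx0
      have h1 : C * x ^ (-α) ≤ 0 := mul_nonpos_of_nonpos_of_nonneg (not_lt.1 hC0) (by positivity)
      rw [one_mul, Real.norm_eq_abs, Real.norm_eq_abs, abs_of_pos hx, abs_of_pos (by linarith)]
      linarith
    obtain ⟨D, hD, hDb⟩ := hO.exists_pos
    refine ⟨C, hCpos, D, hD.le, fun h => absurd h WithTop.coe_ne_top, ?_⟩
    filter_upwards [hDb.bound, eventually_gt_atTop 0] with x hx hx0
    rw [Real.norm_eq_abs, Real.norm_eq_abs, abs_of_nonneg (by positivity : 0 ≤ x ^ (-b)),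
      hsplit x hx0] at hx
    exact hx

/-! ### The numbers and the sizes of the groups -/

lemma eventually_div_three_le_natDiv_two {m : ℕ → ℕ} (hm : Tendsto m atTop atTop) :
    ∀ᶠ N in atTop, (m N : ℝ) / 3 ≤ ((m N / 2 : ℕ) : ℝ) := by
  filter_upwards [hm.eventually_ge_atTop 2] with N hN
  have : m N ≤ 3 * (m N / 2) := by omega
  have : (m N : ℝ) ≤ 3 * ((m N / 2 : ℕ) : ℝ) := by exact_mod_cast this
  linarith

lemma tendsto_exp_of_log {n m : ℕ → ℕ} (hnm : ∀ N, n N * m N ≤ N) (hm : Tendsto m atTop atTop)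
    (hm_log : Tendsto (fun N : ℕ => (m N : ℝ) / Real.log N) atTop atTop) {s : ℝ} (hs : 0 < s) :
    Tendsto (fun N => √(n N : ℝ) * Real.exp (-(((m N / 2 : ℕ) : ℝ) * s))) atTop (𝓝 0) := by
  have hinv : Tendsto (fun N : ℕ => (N : ℝ)⁻¹) atTop (𝓝 0) :=
    tendsto_inv_atTop_zero.comp tendsto_natCast_atTop_atTop
  refine squeeze_zero' (Eventually.of_forall fun _ => by positivity) ?_ hinv
  -- With `m ≥ (6 / s) * log N` and `m / 2 ≥ m / 3` after rounding, the exponential is at most `N ^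
  -- (-2)`, which beats `√n ≤ N`.
  filter_upwards [eventually_div_three_le_natDiv_two hm, hm.eventually_ge_atTop 1,
    hm_log.eventually_ge_atTop (6 / s), eventually_ge_atTop 2] with N h1 h2 h3 h4
  have hN : (2 : ℝ) ≤ N := by exact_mod_cast h4
  have hlog : 0 < Real.log N := Real.log_pos (by linarith)
  have hnN : (n N : ℝ) ≤ N := by exact_mod_cast (Nat.le_mul_of_pos_right _ h2).trans (hnm N)
  have hsqrt : √(n N : ℝ) ≤ N := by
    rw [Real.sqrt_le_left (by linarith)]
    nlinarith
  rw [le_div_iff₀ hlog, div_mul_eq_mul_div, div_le_iff₀ hs] at h3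
  have hexp : Real.exp (-(((m N / 2 : ℕ) : ℝ) * s)) ≤ (N : ℝ)⁻¹ * (N : ℝ)⁻¹ := by
    have h5 : -(((m N / 2 : ℕ) : ℝ) * s) ≤ -Real.log N + -Real.log N := by
      have := mul_le_mul_of_nonneg_right h1 hs.le
      linarith
    refine (Real.exp_le_exp.2 h5).trans (le_of_eq ?_)
    rw [Real.exp_add, Real.exp_neg, Real.exp_log (by linarith)]
  calc _ ≤ (N : ℝ) * ((N : ℝ)⁻¹ * (N : ℝ)⁻¹) := by gcongr
    _ = _ := by field_simp

/-- The exponents are balanced: `ζ / (1 + 2 * ζ)` from `√n` cancels against `m ^ (-ζ)`, leaving `(N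
^ ε N) ^ (-(1 / 2 + ζ))`, which vanishes because `N ^ ε N → ∞`. -/
lemma tendsto_sqrt_mul_rpow {n m : ℕ → ℕ} {ε : ℕ → ℝ} {ζ : ℝ} (hζ : 0 < ζ)
    (hm_top : Tendsto m atTop atTop)
    (hε : Tendsto (fun N : ℕ => (N : ℝ) ^ ε N) atTop atTop)
    (hn : (fun N => (n N : ℝ)) ~[atTop] fun N => (N : ℝ) ^ (2 * ζ / (1 + 2 * ζ) - ε N))
    (hm : (fun N => (m N : ℝ)) ~[atTop] fun N => (N : ℝ) ^ (1 / (1 + 2 * ζ) + ε N)) :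
    Tendsto (fun N => √(n N : ℝ) * ((m N / 2 : ℕ) : ℝ) ^ (-ζ)) atTop (𝓝 0) := by
  have hlim : Tendsto (fun N : ℕ => √2 * 6 ^ ζ * ((N : ℝ) ^ ε N) ^ (-(1 / 2 + ζ))) atTop (𝓝 0) := by
    simpa using ((tendsto_rpow_neg_atTop (by positivity : 0 < 1 / 2 + ζ)).comp hε).const_mul
      (√2 * 6 ^ ζ)
  refine squeeze_zero' (Eventually.of_forall fun _ => by positivity) ?_ hlim
  -- Tolerances `1` and `1 / 2` bound `n` by twice its equivalent and `m` below by half of its own;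
  -- with the rounding constant `3` this produces the `6`.
  have hn2 := hn.isLittleO.bound (show (0 : ℝ) < 1 by norm_num)
  have hm2 := hm.isLittleO.bound (show (0 : ℝ) < 1 / 2 by norm_num)
  filter_upwards [eventually_div_three_le_natDiv_two hm_top, hn2, hm2, eventually_gt_atTop 0]
    with N h1 h2 h3 h4
  have hN : (0 : ℝ) < N := by exact_mod_cast h4
  simp only [Pi.sub_apply, Real.norm_eq_abs, abs_of_pos (Real.rpow_pos_of_pos hN _)] at h2 h3
  have h5 := (abs_sub_le_iff.1 h2).1
  have h6 := (abs_sub_le_iff.1 h3).2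
  have h7 : (N : ℝ) ^ (1 / (1 + 2 * ζ) + ε N) / 6 ≤ ((m N / 2 : ℕ) : ℝ) := by linarith
  have h8 : √(n N : ℝ) ≤ √2 * (N : ℝ) ^ ((2 * ζ / (1 + 2 * ζ) - ε N) / 2) := by
    have : (N : ℝ) ^ ((2 * ζ / (1 + 2 * ζ) - ε N) / 2) =
        √((N : ℝ) ^ (2 * ζ / (1 + 2 * ζ) - ε N)) := by
      rw [Real.sqrt_eq_rpow, ← Real.rpow_mul hN.le]; congr 1; ring
    rw [this, ← Real.sqrt_mul zero_le_two]
    exact Real.sqrt_le_sqrt (by linarith)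
  have hNpos := Real.rpow_pos_of_pos hN (1 / (1 + 2 * ζ) + ε N)
  have h9 : ((m N / 2 : ℕ) : ℝ) ^ (-ζ) ≤ 6 ^ ζ * (N : ℝ) ^ ((1 / (1 + 2 * ζ) + ε N) * (-ζ)) := by
    refine (Real.rpow_le_rpow_of_nonpos (by positivity) h7 (by linarith)).trans (le_of_eq ?_)
    rw [Real.div_rpow hNpos.le (by norm_num), ← Real.rpow_mul hN.le,
      Real.rpow_neg (by norm_num : (0 : ℝ) ≤ 6)]
    field_simp
  calc _ ≤ (√2 * (N : ℝ) ^ ((2 * ζ / (1 + 2 * ζ) - ε N) / 2)) *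
        (6 ^ ζ * (N : ℝ) ^ ((1 / (1 + 2 * ζ) + ε N) * (-ζ))) := by gcongr
    _ = √2 * 6 ^ ζ * ((N : ℝ) ^ ((2 * ζ / (1 + 2 * ζ) - ε N) / 2) *
        (N : ℝ) ^ ((1 / (1 + 2 * ζ) + ε N) * (-ζ))) := by ring
    _ = _ := by
        rw [← Real.rpow_add hN, ← Real.rpow_mul hN.le]
        congr 2
        field_simp
        ring

/-- With `k = m / 2`, write the product as `(√n * k ^ (-ζ)) * (k ^ ζ * exp (-k * s))`; both factors
tend to `0`. -/
lemma tendsto_exp_of_sqrt_mul_rpow {n m : ℕ → ℕ} {ζ : ℝ} (hm : Tendsto m atTop atTop)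
    (h : Tendsto (fun N => √(n N : ℝ) * ((m N / 2 : ℕ) : ℝ) ^ (-ζ)) atTop (𝓝 0)) {s : ℝ}
    (hs : 0 < s) :
    Tendsto (fun N => √(n N : ℝ) * Real.exp (-(((m N / 2 : ℕ) : ℝ) * s))) atTop (𝓝 0) := by
  have hk : Tendsto (fun N => ((m N / 2 : ℕ) : ℝ)) atTop atTop :=
    tendsto_natCast_atTop_atTop.comp ((Nat.tendsto_div_const_atTop two_ne_zero).comp hm)
  have h2 := h.mul ((tendsto_rpow_mul_exp_neg_mul_atTop_nhds_zero ζ s hs).comp hk)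
  rw [mul_zero] at h2
  refine h2.congr' ?_
  filter_upwards [hk.eventually_gt_atTop 0] with N hN
  simp only [Function.comp_apply]
  rw [Real.rpow_neg hN.le, show -s * ((m N / 2 : ℕ) : ℝ) = -(((m N / 2 : ℕ) : ℝ) * s) by ring]
  have := Real.rpow_pos_of_pos hN ζ
  field_simp

lemma tendsto_groupNumber {α : ℝ} {β : WithTop ℝ} {ε : ℕ → ℝ} {n : ℕ → ℕ}
    (hε : ∃ c < groupNumberExponent α β, ∀ᶠ N in atTop, ε N ≤ c)
    (hn : (fun N => (n N : ℝ)) ~[atTop] fun N => (N : ℝ) ^ (groupNumberExponent α β - ε N)) :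
    Tendsto n atTop atTop := by
  obtain ⟨c, hc, hεc⟩ := hε
  refine tendsto_natCast_atTop_iff.1 (hn.symm.tendsto_atTop ?_)
  refine tendsto_atTop_mono' _ ?_
    ((tendsto_rpow_atTop (sub_pos.2 hc)).comp (tendsto_natCast_atTop_atTop (R := ℝ)))
  filter_upwards [hεc, eventually_ge_atTop 1] with N h1 h2
  exact Real.rpow_le_rpow_of_exponent_le (by exact_mod_cast h2) (by linarith)

lemma tendsto_groupSize {α : ℝ} {β : WithTop ℝ} (hβ : 0 ≤ groupSizeExponent α β) {ε : ℕ → ℝ}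
    {m : ℕ → ℕ} (hε : Tendsto (fun N : ℕ => (N : ℝ) ^ ε N) atTop atTop)
    (hm : (fun N => (m N : ℝ)) ~[atTop] fun N => (N : ℝ) ^ (groupSizeExponent α β + ε N)) :
    Tendsto m atTop atTop := by
  refine tendsto_natCast_atTop_iff.1 (hm.symm.tendsto_atTop (tendsto_atTop_mono' _ ?_ hε))
  filter_upwards [eventually_ge_atTop 1] with N h2
  exact Real.rpow_le_rpow_of_exponent_le (by exact_mod_cast h2) (by linarith)

lemma groupSizeExponent_nonneg {α : ℝ} (hα : 0 < α) {β : WithTop ℝ} (hαβ : (α : WithTop ℝ) < β) :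
    0 ≤ groupSizeExponent α β := by
  induction β with
  | top => exact le_rfl
  | coe b =>
    have hb : 0 < b - α := sub_pos.2 (WithTop.coe_lt_coe.1 hαβ)
    simp only [groupSizeExponent]
    positivity

theorem mainTheorem5
    {K : Type*} [EMetricSpace K] [AddCommMonoid K] [DistribMulAction {a : ℝ // 0 < a} K]
    [NormedCone K] [MeasurableSpace K] [BorelSpace K]
    {Ω : Type*} [MeasurableSpace Ω] (P : Measure Ω) [IsProbabilityMeasure P]
    (ξ : ℕ → Ω → K) (hmeas : ∀ i, Measurable (ξ i))
    (hindep : iIndepFun ξ P) (hident : ∀ i, IdentDistrib (ξ i) (ξ 0) P P)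
    (hpunctured : ∀ i, ∀ᵐ ω ∂P, ξ i ω ∈ NormedCone.punctured K)
    (α : ℝ) (σ : Measure (NormedCone.unitSphere K)) [IsProbabilityMeasure σ]
    (hVR : RegularlyVaryingTail P (ξ 0) α σ)
    (β : WithTop ℝ) (hαβ : (α : WithTop ℝ) < β)
    (htail : SecondOrderTail (fun x : ℝ => P.real {ω | x < NormedCone.cnorm (ξ 0 ω)}) α β)
    (ε : ℕ → ℝ)
    (hε_small : ∃ c < groupNumberExponent α β, ∀ᶠ N in atTop, ε N ≤ c)
    (hε_large : Tendsto (fun N : ℕ => (N : ℝ) ^ ε N) atTop atTop)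
    (n m : ℕ → ℕ) (hnm : ∀ N, n N * m N ≤ N)
    (hn : (fun N => (n N : ℝ)) ~[atTop] fun N => (N : ℝ) ^ (groupNumberExponent α β - ε N))
    (hm : (fun N => (m N : ℝ)) ~[atTop] fun N => (N : ℝ) ^ (groupSizeExponent α β + ε N))
    (hm_log : β = ⊤ → Tendsto (fun N : ℕ => (m N : ℝ) / Real.log N) atTop atTop) :
    TendstoInDistribution
      (fun N ω =>
        √(n N : ℝ) * (tailIndexEstimator (fun k => NormedCone.cnorm (ξ k ω)) (n N) (m N) - α) /
          ((α + 1) ^ 2 * √(kappaVariance (fun k => NormedCone.cnorm (ξ k ω)) (n N) (m N))))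
      atTop (id : ℝ → ℝ) (fun _ => P) (gaussianReal 0 1) ∧
    TendstoInDistribution
      (fun N ω =>
        √(n N : ℝ) * (tailIndexEstimator (fun k => NormedCone.cnorm (ξ k ω)) (n N) (m N) - α))
      atTop (id : ℝ → ℝ) (fun _ => P)
      (gaussianReal 0 (Real.toNNReal (α * (α + 1) ^ 2 / (α + 2)))) := by

  obtain ⟨L, hL, hVR'⟩ := hVR.exists_slowlyVarying
  have hα : 0 < α := hVR.1
  obtain ⟨C, hC, D, hD, hDtop, hbound⟩ := htail.exists_pos hL hVR' hαβ
  have hn_top := tendsto_groupNumber hε_small hn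
  have hm_top := tendsto_groupSize (groupSizeExponent_nonneg hα hαβ) hε_large hm
  -- For `β = ⊤` the default `α + 1` makes this exponent `1`; any positive value would do, since
  -- then `D = 0`.
  have hδ : 0 < β.untopD (α + 1) - α := by
    induction β with
    | top => simp
    | coe b => simpa using hαβ
  have hrates : Tendsto (fun N => √(n N : ℝ) *
        (D * ((m N / 2 : ℕ) : ℝ) ^ (-((β.untopD (α + 1) - α) / α)))) atTop (𝓝 0) ∧
      ∀ s : ℝ, 0 < s →
        Tendsto (fun N => √(n N : ℝ) * Real.exp (-(((m N / 2 : ℕ) : ℝ) * s))) atTop (𝓝 0) := by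
    induction β with
    | top =>
      refine ⟨?_, fun s hs => tendsto_exp_of_log hnm hm_top (hm_log rfl) hs⟩
      simp [hDtop rfl]
    | coe b =>
      have h := tendsto_sqrt_mul_rpow (div_pos hδ hα) hm_top hε_large hn hm
      refine ⟨?_, fun s hs => tendsto_exp_of_sqrt_mul_rpow hm_top h hs⟩
      simpa [mul_left_comm] using h.const_mul D
  have hcnorm := NormedCone.measurable_cnorm (K := K)
  exact tendstoInDistribution_tailIndexEstimator
    (Y := fun k ω => NormedCone.cnorm (ξ k ω)) (fun i => hcnorm.comp (hmeas i))
    (hindep.comp (fun _ => NormedCone.cnorm) fun _ => hcnorm)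
    (fun i => (hident i).comp hcnorm) hα hC hD hδ
    (((NNReal.tendsto_coe_atTop.2 tendsto_id).eventually hbound).mono fun x hx => by
      simpa only [id, NNReal.coe_lt_coe] using hx)
    hn_top hm_top hrates.1 hrates.2
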